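/- **Setting.** A *Bernays–Schönfinkel (EPR) instance* is a finite set $\varphi$ of clauses (finite disjunctions of literals) of first-order logic without equality, in which every term is a variable or a constant symbol; all variables are universally quantified, predicate symbols have fixed arities, and $\varphi$ is *satisfiable* if some first-order interpretation with non-empty domain makes the universal closure of every clause true. The instance is in the *QEALM-fragment* if in every clause, whenever a variable $u$ occurs in several literals $l_1,\dots,l_k$ of that clause, 1. the first (lowest) argument position $i$ at which $u$ occurs is the same in all of $l_1,\dots,l_k$, and 2. for every position $j\le i$, the $j$-th arguments of $l_1,\dots,l_k$ are all equal. **Theorem.** The problem of deciding whether a given instance of the QEALM-fragment is satisfiable is $\mathsf{PSPACE}$-hard under polynomial-time many-one reductions, even when it is restricted to the instances with the following three properties simultaneously: 1. (Krom) every clause has at most $2$ literals; 2. (Horn) every clause has at most one positive literal; 3. (Affine) for every two-literal clause $a\rightarrow b$ (that is, $\neg a\vee b$, with $a,b$ literals) of the instance, the opposite implication $b\rightarrow a$ (that is, $a\vee\neg b$) is also a clause of the instance. That is, for every language $L$ in $\mathsf{PSPACE}$ there is a polynomial-time computable function mapping each word $w$ to an instance $f(w)$ of the QEALM-fragment with properties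 1–3 such that $w\in L$ if and only if $f(w)$ is satisfiable. -/

import Mathlib

/-! ### Bernays–Schönfinkel (EPR) instances in clausal form -/

namespace EPR

/-- A function-free first-order term: a variable or a constant symbol. -/
inductive Term where
  | var (u : ℕ)
  | const (c : ℕ)
  deriving DecidableEq

/-- A literal `p(t₁, …, t_m)` (`positive = true`) or `¬ p(t₁, …, t_m)` (`positive = false`),
without equality. -/
structure Literal where
  positive : Bool
  pred : ℕ
  args : List Term
  deriving DecidableEq

/-- The complementary literal. -/
def Literal.compl (l : Literal) : Literal := { l with positive := !l.positive }

/-- A clause: the disjunction of its literals, all of whose variables are universally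
quantified. -/
abbrev Clause := List Literal

/-- A clause set: the conjunction of its clauses. -/
abbrev ClauseSet := List Clause

/-- An interpretation with domain `D`: an element for every constant symbol, and a relation for
every predicate symbol. The domain is non-empty, since constants are interpreted in it. -/
structure Interpretation (D : Type) where
  const : ℕ → D
  pred : ℕ → List D → Prop

def Interpretation.term {D : Type} (I : Interpretation D) (v : ℕ → D) : Term → D
  | Term.var u => v u
  | Term.const c => I.const c

def Interpretation.HoldsLiteral {D : Type} (I : Interpretation D) (v : ℕ → D) (l : Literal) :
    Prop :=
  if l.positive then I.pred l.pred (l.args.map (I.term v))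
  else ¬ I.pred l.pred (l.args.map (I.term v))

/-- The universal closure of the clause holds in `I`. -/
def Interpretation.HoldsClause {D : Type} (I : Interpretation D) (C : Clause) : Prop :=
  ∀ v : ℕ → D, ∃ l ∈ C, I.HoldsLiteral v l

/-- First-order satisfiability of (the universal closure of) a clause set. -/
def Satisfiable (φ : ClauseSet) : Prop :=
  ∃ (D : Type) (I : Interpretation D), ∀ C ∈ φ, I.HoldsClause C

/-- Well-formedness: clauses are sets of literals, listed without repetition, and every predicate
symbol is used with one arity throughout. -/
def WellFormed (φ : ClauseSet) : Prop :=
  (∀ C ∈ φ, C.Nodup) ∧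
  ∀ C ∈ φ, ∀ C' ∈ φ, ∀ l ∈ C, ∀ l' ∈ C', l.pred = l'.pred → l.args.length = l'.args.length

/-- The first (lowest) position at which the variable `u` occurs among the arguments of `l`,
counted from `0`; used only for variables that do occur in `l`. -/
def Literal.firstPos (l : Literal) (u : ℕ) : ℕ := l.args.idxOf (Term.var u)

/-- The QEALM-fragment: if a variable `u` occurs in several literals of one clause, then its first
position `i` is the same in all of them, and these literals have the same `j`-th argument for
all `j ≤ i`. -/
def QEALM (φ : ClauseSet) : Prop :=
  ∀ C ∈ φ, ∀ l ∈ C, ∀ l' ∈ C, ∀ u : ℕ, Term.var u ∈ l.args → Term.var u ∈ l'.args →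
    l.firstPos u = l'.firstPos u ∧ ∀ j ≤ l.firstPos u, l.args[j]? = l'.args[j]?

/-- Every clause has at most two literals. -/
def Krom (φ : ClauseSet) : Prop := ∀ C ∈ φ, C.length ≤ 2

/-- Every clause has at most one positive literal. -/
def Horn (φ : ClauseSet) : Prop := ∀ C ∈ φ, C.countP (fun l => l.positive) ≤ 1

/-- For every two-literal clause `l₁ ∨ l₂`, that is, `l₁.compl → l₂`, the opposite implication
`l₂ → l₁.compl`, that is, `l₁.compl ∨ l₂.compl`, is a clause as well (in either order). -/
def Affine (φ : ClauseSet) : Prop :=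
  ∀ l₁ l₂ : Literal, [l₁, l₂] ∈ φ →
    [l₁.compl, l₂.compl] ∈ φ ∨ [l₂.compl, l₁.compl] ∈ φ

/-! ### Clause sets as strings -/

/-- The finite alphabet in which clause sets are written. -/
inductive Symb where
  | tick | var | const | pos | neg | endClause
  deriving DecidableEq

/-- Names of symbols are written in unary. This makes inputs longer than binary names would, so
that hardness is the stronger claim. -/
def unary (n : ℕ) : List Symb := List.replicate n Symb.tick

def Term.encode : Term → List Symb
  | Term.var u => Symb.var :: unary u
  | Term.const c => Symb.const :: unary c

def Literal.encode (l : Literal) : List Symb :=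
  (if l.positive then Symb.pos else Symb.neg) :: (unary l.pred ++ l.args.flatMap Term.encode)

def Clause.encode (C : Clause) : List Symb := C.flatMap Literal.encode ++ [Symb.endClause]

def ClauseSet.encode (φ : ClauseSet) : List Symb := φ.flatMap Clause.encode

theorem unary_append_inj {m n : ℕ} {r s : List Symb} (hr : r.head? ≠ some Symb.tick)
    (hs : s.head? ≠ some Symb.tick) (h : unary m ++ r = unary n ++ s) : m = n ∧ r = s := by
  induction m generalizing n with
  | zero =>
    cases n with
    | zero => simpa [unary] using h
    | succ n => simp [unary, List.replicate_succ] at h; simp [h] at hr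
  | succ m ih =>
    cases n with
    | zero => simp [unary, List.replicate_succ] at h; simp [← h] at hs
    | succ n =>
      simp only [unary, List.replicate_succ, List.cons_append, List.cons.injEq, true_and] at h
      have := ih (n := n) h
      exact ⟨by omega, this.2⟩

/-- The remainder of a word after an argument list. -/
def Boundary (r : List Symb) : Prop :=
  r.head? ≠ some Symb.tick ∧ r.head? ≠ some Symb.var ∧ r.head? ≠ some Symb.const

theorem args_head (ts : List Term) {r : List Symb} (hr : Boundary r) :
    (ts.flatMap Term.encode ++ r).head? ≠ some Symb.tick := by
  cases ts with
  | nil => simpa using hr.1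
  | cons t ts => cases t <;> simp [Term.encode]

theorem args_append_inj {ts us : List Term} {r s : List Symb} (hr : Boundary r) (hs : Boundary s)
    (h : ts.flatMap Term.encode ++ r = us.flatMap Term.encode ++ s) : ts = us ∧ r = s := by
  induction ts generalizing us with
  | nil =>
    cases us with
    | nil => simpa using h
    | cons u us =>
      cases u <;> simp [Term.encode] at h <;> simp [Boundary, h] at hr
  | cons t ts ih =>
    cases us with
    | nil => cases t <;> simp [Term.encode] at h <;> simp [Boundary, ← h] at hs
    | cons u us =>
      cases t <;> cases u <;>
        simp only [List.flatMap_cons, Term.encode, List.cons_append, List.append_assoc,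
          List.cons.injEq, true_and, reduceCtorEq, false_and] at h
      all_goals
        obtain ⟨h1, h2⟩ := unary_append_inj (args_head ts hr) (args_head us hs) h
        obtain ⟨h3, h4⟩ := ih h2
        subst h1 h3
        exact ⟨rfl, h4⟩

theorem clause_boundary (C : Clause) (r : List Symb) :
    Boundary (C.flatMap Literal.encode ++ Symb.endClause :: r) := by
  cases C with
  | nil => simp [Boundary]
  | cons l C => cases l with | mk b p a => cases b <;> simp [Boundary, Literal.encode]

theorem clause_append_inj {C C' : Clause} {r s : List Symb}
    (h : C.flatMap Literal.encode ++ Symb.endClause :: r =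
      C'.flatMap Literal.encode ++ Symb.endClause :: s) : C = C' ∧ r = s := by
  induction C generalizing C' with
  | nil =>
    cases C' with
    | nil => simpa using h
    | cons l C' => cases l with | mk b p a => cases b <;> simp [Literal.encode] at h
  | cons l C ih =>
    obtain ⟨b, p, a⟩ := l
    cases C' with
    | nil => cases b <;> simp [Literal.encode] at h
    | cons l' C' =>
      obtain ⟨b', p', a'⟩ := l'
      have hb : b = b' := by cases b <;> cases b' <;> simp [Literal.encode] at h ⊢
      subst hb
      simp only [List.flatMap_cons, Literal.encode, List.cons_append, List.append_assoc,
        List.cons.injEq, true_and] at h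
      obtain ⟨h1, h2⟩ := unary_append_inj (args_head a (clause_boundary C r))
        (args_head a' (clause_boundary C' s)) h
      obtain ⟨h3, h4⟩ := args_append_inj (clause_boundary C r) (clause_boundary C' s) h2
      obtain ⟨h5, h6⟩ := ih h4
      subst h1 h3 h5
      exact ⟨rfl, h6⟩

/-- Different clause sets are written as different strings. -/
theorem ClauseSet.encode_injective : Function.Injective ClauseSet.encode := by
  intro φ ψ h
  induction φ generalizing ψ with
  | nil =>
    cases ψ with
    | nil => rfl
    | cons C ψ => simp [ClauseSet.encode, Clause.encode] at h
  | cons C φ ih =>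
    cases ψ with
    | nil => simp [ClauseSet.encode, Clause.encode] at h
    | cons C' ψ =>
      simp only [ClauseSet.encode, List.flatMap_cons, Clause.encode, List.append_assoc,
        List.singleton_append] at h
      obtain ⟨h1, h2⟩ := clause_append_inj h
      rw [h1, ih h2]

end EPR

/-! ### Polynomial space -/

/-- A deterministic Turing machine with a single one-way infinite tape, for inputs over the
alphabet `α`. It halts when the transition function returns `none`. -/
structure SingleTapeTM (α : Type) where
  /-- states -/
  Q : Type
  [finQ : Finite Q]
  /-- tape alphabet -/
  Γ : Type
  [finΓ : Finite Γ]
  blank : Γ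
  /-- the input alphabet as a part of the tape alphabet that does not contain the blank -/
  input : α → Γ
  input_injective : Function.Injective input
  input_ne_blank : ∀ a, input a ≠ blank
  start : Q
  /-- accepting states -/
  accept : Set Q
  /-- next state, symbol written, and move of the head -/
  δ : Q → Γ → Option (Q × Γ × Turing.Dir)

namespace SingleTapeTM

variable {α : Type} (M : SingleTapeTM α)

/-- A configuration; the cells of the tape are numbered `0, 1, 2, …`. -/
structure Cfg where
  state : M.Q
  head : ℕ
  tape : ℕ → M.Γ

/-- The input stands at the left end of the tape, followed by blanks, and the head on cell `0`. -/
def init (w : List α) : M.Cfg where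
  state := M.start
  head := 0
  tape i := (w[i]?).elim M.blank M.input

/-- One step; on cell `0` a move to the left leaves the head where it is. -/
def step (c : M.Cfg) : Option M.Cfg :=
  (M.δ c.state (c.tape c.head)).map fun r =>
    { state := r.1
      head := match r.2.2 with
        | Turing.Dir.left => c.head - 1
        | Turing.Dir.right => c.head + 1
      tape := Function.update c.tape c.head r.2.1 }

/-- `M` halts on every input, accepts exactly the members of `L`, and scans at most `s n` cells
on inputs of length `n`. -/
def DecidesInSpace (L : Set (List α)) (s : ℕ → ℕ) : Prop :=
  ∀ w : List α,
    (∃ c ∈ StateTransition.eval M.step (M.init w), (c.state ∈ M.accept ↔ w ∈ L)) ∧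
    ∀ c, StateTransition.Reaches M.step (M.init w) c → c.head < s w.length

end SingleTapeTM

/-- The language `L` is in PSPACE. -/
def InPSPACE {α : Type} (L : Set (List α)) : Prop :=
  ∃ (M : SingleTapeTM α) (s : Polynomial ℕ), M.DecidesInSpace L (fun n => s.eval n)

/-- Let the objects of type `β` be written as strings by `enc`. The problem, given an instance
from `D`, to decide whether it belongs to `P` is PSPACE-hard: every language in PSPACE, over any
finite alphabet, has a polynomial-time many-one reduction to it that produces only instances
from `D`. -/
def PSPACEHard {β S : Type} (enc : β → List S) (D P : Set β) : Prop :=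
  ∀ (α : Type) [Fintype α] (L : Set (List α)), InPSPACE L →
    ∃ f : List α → β,
      Nonempty (Turing.TM2ComputableInPolyTime (id : List α → List α) enc f) ∧
      (∀ w, f w ∈ D) ∧ ∀ w, w ∈ L ↔ f w ∈ P

/-! ### A structured programming language for stack machines -/

namespace StackProg

open Turing Function

variable {K : Type} {Γ : K → Type}

/-! Let `N` be a polynomial space bound for the machine on the given input. A configuration is a
list of `N` symbol codes and one entry that codes state and head position together, so a transition
changes one cell and the last entry. Halting in a non-accepting state is followed by one more
transition, to the code `0`; the word is rejected iff a configuration with code `0` is reachable.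
Clauses that come in opposite pairs can only express undirected reachability. Nothing is lost: for a
deterministic machine, acceptance is invariant under transitions in both directions
(`good_iff_of_stepRel`). A halting run visits at most `2 ^ K` configurations, with `K` linear in
`N`, and paths are found by bisection (`PathLE`).

The clauses simulate this recursion. Predicate `d` holds a call stack of `d + 1` pairs of
configurations, the last pair being the current query, and a mode: `0` for a call, `1` for a return.
A call on `(a, b)` is equivalent to a call on `(x, a)` pushed above it, for every `x`; the return
from `(x, a)` to the call on `(x, b)`; the return from `(x, b)` to the return from `(a, b)`. At
depth `K`, call and return are equivalent for equal or adjacent pairs. Two unit clauses say that,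
for every configuration with code `0`, the query about a path to it from the initial one is called
and does not return. As `x` is written before the copy of `a` or `b`, the two atoms of a clause
share a prefix that contains all their common variables, which gives the QEALM condition
(`Rule.sharedPrefix`).

If a path exists, calls and returns along the recursion are equivalent in every model, a
contradiction (`IsPathModel.pred_iff`). If none exists, `val` defines a model
(`satisfiable_of_not_pathLE`).

Polynomial-time computability rests on a small language of stack programs, compiled to `TM2`
machines (`Cmd.code_correct`), and on generators with loops over unary registers (`Gen.exec`), one
of which writes the encoded clause set (`Gen.den_pathGen`). -/

/-- Structured programs over a family of stacks. -/
inductive Cmd (Γ : K → Type) : Type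
  | skip : Cmd Γ
  | push (k : K) (a : Γ k) : Cmd Γ
  | seq (c d : Cmd Γ) : Cmd Γ
  /-- While the stack `k` is not empty, pop a symbol `a` from it and run `f a`. -/
  | loop (k : K) (f : Γ k → Cmd Γ) : Cmd Γ
  | ifEmpty (k : K) (c d : Cmd Γ) : Cmd Γ

section

variable [DecidableEq K]

/-- `Exec c S S' t`: started on the stacks `S`, the program `c` terminates after `t` steps with
the stacks `S'`. -/
inductive Exec : Cmd Γ → (∀ k, List (Γ k)) → (∀ k, List (Γ k)) → ℕ → Prop
  | skip (S) : Exec .skip S S 1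
  | push (k a S) : Exec (.push k a) S (update S k (a :: S k)) 1
  | seq {c d S S' S'' m n} (hc : Exec c S S' m) (hd : Exec d S' S'' n) :
      Exec (.seq c d) S S'' (n + m)
  | loop_nil {k f S} (h : S k = []) : Exec (.loop k f) S S 1
  | loop_cons {k f S S' S'' a l m n} (h : S k = a :: l)
      (hc : Exec (f a) (update S k l) S' m) (hd : Exec (.loop k f) S' S'' n) :
      Exec (.loop k f) S S'' (n + (m + 1))
  | if_nil {k c d S S' m} (h : S k = []) (hc : Exec c S S' m) :
      Exec (.ifEmpty k c d) S S' (m + 1)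
  | if_cons {k c d S S' m} (h : S k ≠ []) (hd : Exec d S S' m) :
      Exec (.ifEmpty k c d) S S' (m + 1)

end

namespace Cmd

/-- The program points of a program. -/
def Label : Cmd Γ → Type
  | skip => Unit
  | push _ _ => Unit
  | seq c d => c.Label ⊕ d.Label
  | loop _ f => Option (Σ a, (f a).Label)
  | ifEmpty _ c d => Option (c.Label ⊕ d.Label)

/-- The program point at which a program starts. -/
def entry : (c : Cmd Γ) → c.Label
  | skip => ()
  | push _ _ => ()
  | seq c _ => .inl c.entry
  | loop _ _ => none
  | ifEmpty _ _ _ => none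

theorem finite_label [∀ k, Finite (Γ k)] : (c : Cmd Γ) → Finite c.Label
  | skip => inferInstanceAs (Finite Unit)
  | push _ _ => inferInstanceAs (Finite Unit)
  | seq c d =>
    have := c.finite_label
    have := d.finite_label
    inferInstanceAs (Finite (c.Label ⊕ d.Label))
  | loop _ f =>
    have := fun a => (f a).finite_label
    inferInstanceAs (Finite (Option (Σ a, (f a).Label)))
  | ifEmpty _ c d =>
    have := c.finite_label
    have := d.finite_label
    inferInstanceAs (Finite (Option (c.Label ⊕ d.Label)))

/-- The internal states of the stack machines: the last symbol read from each stack. -/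
abbrev Mem (Γ : K → Type) : Type := ∀ k, Option (Γ k)

variable [DecidableEq K]

/-- The code of a program that is embedded by `e` into a larger program and leaves to `x`. -/
def code {Λ : Type} : (c : Cmd Γ) → (c.Label → Λ) → Λ → c.Label → TM2.Stmt Γ Λ (Mem Γ)
  | skip, _, x, _ => .goto fun _ => x
  | push k a, _, x, _ => .push k (fun _ => a) (.goto fun _ => x)
  | seq c d, e, _, .inl l => c.code (fun l => e (.inl l)) (e (.inr d.entry)) l
  | seq _ d, e, x, .inr l => d.code (fun l => e (.inr l)) x l
  | loop k f, e, x, none =>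
    .pop k (fun v o => update v k o)
      (.goto fun v => (v k).elim x fun a => e (some ⟨a, (f a).entry⟩))
  | loop _ f, e, _, some ⟨a, l⟩ => (f a).code (fun l => e (some ⟨a, l⟩)) (e none) l
  | ifEmpty k c d, e, _, none =>
    .peek k (fun v o => update v k o)
      (.goto fun v => (v k).elim (e (some (.inl c.entry))) fun _ => e (some (.inr d.entry)))
  | ifEmpty _ c _, e, x, some (.inl l) => c.code (fun l => e (some (.inl l))) x l
  | ifEmpty _ _ d, e, x, some (.inr l) => d.code (fun l => e (some (.inr l))) x l

/-- `n` steps of a stack machine. -/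
def steps {Λ : Type} (M : Λ → TM2.Stmt Γ Λ (Mem Γ)) (n : ℕ)
    (c : Option (TM2.Cfg Γ Λ (Mem Γ))) : Option (TM2.Cfg Γ Λ (Mem Γ)) :=
  (flip bind (TM2.step M))^[n] c

theorem steps_add {Λ : Type} (M : Λ → TM2.Stmt Γ Λ (Mem Γ)) (m n : ℕ)
    (c : Option (TM2.Cfg Γ Λ (Mem Γ))) : steps M (n + m) c = steps M n (steps M m c) := by
  simp [steps, iterate_add_apply]

theorem steps_one {Λ : Type} (M : Λ → TM2.Stmt Γ Λ (Mem Γ)) (l : Λ) (v : Mem Γ)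
    (S : ∀ k, List (Γ k)) :
    steps M 1 (some ⟨some l, v, S⟩) = some (TM2.stepAux (M l) v S) := by
  simp [steps, flip, TM2.step]

/-- The embedding `e` and the exit `x` vary in the induction, because a subprogram sits at labels of
the surrounding program and leaves to one of them. The step counts of `Exec` are exactly those of
the machine. -/
theorem code_correct {Λ : Type} (M : Λ → TM2.Stmt Γ Λ (Mem Γ)) {c : Cmd Γ}
    {S S' : ∀ k, List (Γ k)} {t : ℕ} (h : Exec c S S' t) :
    ∀ (e : c.Label → Λ) (x : Λ), (∀ l, M (e l) = c.code e x l) → ∀ v : Mem Γ,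
      ∃ v' : Mem Γ, steps M t (some ⟨some (e c.entry), v, S⟩) = some ⟨some x, v', S'⟩ := by
  induction h with
  | skip S =>
    intro e x hM v
    exact ⟨v, by rw [steps_one, hM]; rfl⟩
  | push k a S =>
    intro e x hM v
    exact ⟨v, by rw [steps_one, hM]; rfl⟩
  | @seq c d S S' S'' m n hc hd ihc ihd =>
    intro e x hM v
    obtain ⟨v₁, h₁⟩ := ihc (fun l => e (.inl l)) (e (.inr d.entry)) (fun l => hM (.inl l)) v
    obtain ⟨v₂, h₂⟩ := ihd (fun l => e (.inr l)) x (fun l => hM (.inr l)) v₁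
    exact ⟨v₂, by rw [steps_add]; exact (congrArg _ h₁).trans h₂⟩
  | @loop_nil k f S h =>
    intro e x hM v
    refine ⟨update v k none, ?_⟩
    rw [steps_one, hM]
    -- Popping an empty stack does not change it.
    have h' : update S k (S k).tail = S := update_eq_self_iff.2 (by rw [h]; rfl)
    simp only [entry, code, TM2.stepAux, h', update_self]
    simp [h]
  | @loop_cons k f S S' S'' a l m n h hc hd ihc ihd =>
    intro e x hM v
    obtain ⟨v₁, h₁⟩ := ihc (fun l => e (some ⟨a, l⟩)) (e none) (fun l => hM (some ⟨a, l⟩))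
      (update v k (some a))
    obtain ⟨v₂, h₂⟩ := ihd e x hM v₁
    refine ⟨v₂, ?_⟩
    rw [steps_add, steps_add, steps_one, hM]
    simp only [entry, code, TM2.stepAux, h, List.head?_cons, List.tail_cons, update_self,
      Option.elim_some]
    exact (congrArg _ h₁).trans h₂
  | @if_nil k c d S S' m h hc ihc =>
    intro e x hM v
    obtain ⟨v₁, h₁⟩ := ihc (fun l => e (some (.inl l))) x (fun l => hM (some (.inl l)))
      (update v k none)
    refine ⟨v₁, ?_⟩
    rw [steps_add, steps_one, hM]
    simpa only [entry, code, TM2.stepAux, h, List.head?_nil, update_self,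
      Option.elim_none] using h₁
  | @if_cons k c d S S' m h hd ihd =>
    intro e x hM v
    obtain ⟨a, l, hl⟩ := List.exists_cons_of_ne_nil h
    obtain ⟨v₁, h₁⟩ := ihd (fun l => e (some (.inr l))) x (fun l => hM (some (.inr l)))
      (update v k (some a))
    refine ⟨v₁, ?_⟩
    rw [steps_add, steps_one, hM]
    simpa only [entry, code, TM2.stepAux, hl, List.head?_cons, update_self,
      Option.elim_some] using h₁

end Cmd

variable [DecidableEq K]

/-- `c` leads from `S` to `S'` in at most `T` steps. -/
def ExecLE (c : Cmd Γ) (S S' : ∀ k, List (Γ k)) (T : ℕ) : Prop := ∃ t ≤ T, Exec c S S' t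

namespace ExecLE

variable {c d : Cmd Γ} {S S' S'' : ∀ k, List (Γ k)} {T T' : ℕ}

theorem mono (h : ExecLE c S S' T) (hT : T ≤ T') : ExecLE c S S' T' :=
  let ⟨t, ht, h⟩ := h
  ⟨t, ht.trans hT, h⟩

theorem skip (S : ∀ k, List (Γ k)) : ExecLE .skip S S 1 := ⟨1, le_rfl, .skip S⟩

theorem push (k : K) (a : Γ k) (S : ∀ k, List (Γ k)) :
    ExecLE (.push k a) S (update S k (a :: S k)) 1 := ⟨1, le_rfl, .push k a S⟩

theorem seq (hc : ExecLE c S S' T) (hd : ExecLE d S' S'' T') :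
    ExecLE (.seq c d) S S'' (T + T') :=
  let ⟨t, ht, hc⟩ := hc
  let ⟨t', ht', hd⟩ := hd
  ⟨t' + t, by omega, .seq hc hd⟩

theorem if_nil {k : K} (h : S k = []) (hc : ExecLE c S S' T) :
    ExecLE (.ifEmpty k c d) S S' (T + 1) :=
  let ⟨t, ht, hc⟩ := hc
  ⟨t + 1, by omega, .if_nil h hc⟩

theorem if_cons {k : K} (h : S k ≠ []) (hd : ExecLE d S S' T) :
    ExecLE (.ifEmpty k c d) S S' (T + 1) :=
  let ⟨t, ht, hd⟩ := hd
  ⟨t + 1, by omega, .if_cons h hd⟩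

/-- `X t` prescribes the stacks after `t` rounds. The body starts after the pop, hence the `update`;
each round costs one step for the pop, and the final test one more. -/
theorem loop {k : K} {f : Γ k → Cmd Γ} (l : List (Γ k)) (X : ℕ → ∀ k, List (Γ k))
    (hX : ∀ t ≤ l.length, X t k = l.drop t)
    (hf : ∀ t (ht : t < l.length),
      ExecLE (f l[t]) (update (X t) k (l.drop (t + 1))) (X (t + 1)) T) :
    ExecLE (.loop k f) (X 0) (X l.length) (l.length * (T + 1) + 1) := by
  induction l generalizing X with
  | nil => exact ⟨1, by simp, .loop_nil (by simpa using hX 0)⟩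
  | cons a l ih =>
    obtain ⟨t, ht, h⟩ := ih (fun t => X (t + 1)) (fun t ht => by simpa using hX (t + 1) (by simpa))
      (fun t ht => hf (t + 1) (by simpa))
    obtain ⟨t', ht', h'⟩ := hf 0 (by simp)
    refine ⟨t + (t' + 1), ?_, .loop_cons (by simpa using hX 0) h' h⟩
    simp only [List.length_cons, Nat.add_mul]
    omega

end ExecLE

/-- The stacks that are empty, except that `k` contains `l`. -/
def single (k : K) (l : List (Γ k)) : ∀ k, List (Γ k) := update (fun _ => []) k l

/-- The code of a program as a complete stack machine. -/
def Cmd.machineCode (c : Cmd Γ) : Option c.Label → TM2.Stmt Γ (Option c.Label) (Cmd.Mem Γ)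
  | some l => c.code some none l
  -- A halting configuration must carry the initial internal state, so the memory is erased; this is
  -- the extra step in the time bound `p + 1`.
  | none => .load (fun _ _ => none) .halt

/-- The stack machine of a program. -/
noncomputable def Cmd.machine [Fintype K] [∀ k, Finite (Γ k)] (c : Cmd Γ) (k₀ k₁ : K) : FinTM2 where
  K := K
  k₀ := k₀
  k₁ := k₁
  Γ := Γ
  Λ := Option c.Label
  main := some c.entry
  ΛFin := have := c.finite_label; Fintype.ofFinite _
  σ := Cmd.Mem Γ
  initialState := fun _ => none
  σFin := Fintype.ofFinite _
  Γk₀Fin := Fintype.ofFinite _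
  m := c.machineCode

/-- The left side is the form in which `initList` and `haltList` give the stacks. -/
theorem dite_eq_single (k : K) (l : List (Γ k)) :
    (fun k' => @dite (List (Γ k')) (k' = k) (inferInstance) (fun h => by rw [h]; exact l)
      fun _ => []) = single k l := by
  funext k'
  by_cases h : k' = k
  · subst h; simp [single]
  · simp [single, h]

/-- Functions computed by programs in polynomial time are computable in polynomial time. -/
theorem computableInPolyTime [Fintype K] [∀ k, Finite (Γ k)] {β : Type} {k₀ k₁ : K}
    (enc : β → List (Γ k₁)) (f : List (Γ k₀) → β) (c : Cmd Γ) (p : Polynomial ℕ)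
    (h : ∀ w, ExecLE c (single k₀ w) (single k₁ (enc (f w))) (p.eval w.length)) :
    Nonempty (TM2ComputableInPolyTime (id : List (Γ k₀) → List (Γ k₀)) enc f) := by
  refine ⟨{ tm := c.machine k₀ k₁
            inputAlphabet := Equiv.refl _
            outputAlphabet := Equiv.refl _
            time := p + 1
            outputsFun := fun w => ?_ }⟩
  apply Classical.choice
  obtain ⟨t, ht, hc⟩ := h w
  obtain ⟨v, hv⟩ := Cmd.code_correct c.machineCode hc some none (fun _ => rfl)
    (fun _ => none)
  refine ⟨⟨⟨1 + t, ?_⟩, ?_⟩⟩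
  · have h₁ : initList (c.machine k₀ k₁) (List.map (Equiv.refl (Γ k₀)).invFun (id w)) =
        (⟨some (some c.entry), fun _ => none, single k₀ w⟩ : TM2.Cfg Γ _ (Cmd.Mem Γ)) := by
      rw [← dite_eq_single]
      exact congrArg (initList (c.machine k₀ k₁)) (List.map_id w)
    have h₂ : haltList (c.machine k₀ k₁) (List.map (Equiv.refl (Γ k₁)).invFun (enc (f w))) =
        (⟨none, fun _ => none, single k₁ (enc (f w))⟩ : TM2.Cfg Γ _ (Cmd.Mem Γ)) := by
      rw [← dite_eq_single]
      exact congrArg (haltList (c.machine k₀ k₁)) (List.map_id (enc (f w)))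
    refine (congrArg (fun x => Cmd.steps c.machineCode (1 + t) (some x)) h₁).trans ?_
    refine Eq.trans ?_ (congrArg some h₂).symm
    rw [Cmd.steps_add, hv, Cmd.steps_one]
    rfl
  · simp only [Polynomial.eval_add, Polynomial.eval_one, id]
    omega

end StackProg

/-! ### Generators: programs that write a string determined by registers -/

namespace StackProg

open Function

/-- The stacks: input, auxiliary copy of the input, output, accumulator, and unary registers. -/
inductive Stk (R : Type) where
  | inp | rev | out | acc
  | reg (r : R)
  deriving DecidableEq

theorem Stk.finite (R : Type) [Finite R] : Finite (Stk R) := by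
  have : Surjective (fun x : Fin 4 ⊕ R =>
      x.elim (fun i => ![Stk.inp, Stk.rev, Stk.out, Stk.acc] i) Stk.reg) := by
    rintro (_ | _ | _ | _ | r)
    exacts [⟨.inl 0, rfl⟩, ⟨.inl 1, rfl⟩, ⟨.inl 2, rfl⟩, ⟨.inl 3, rfl⟩, ⟨.inr r, rfl⟩]
  exact Finite.of_surjective _ this

/-- The alphabets of the stacks. -/
@[reducible] def Alph (α β : Type) {R : Type} : Stk R → Type
  | .inp => α
  | .rev => α
  | .out => β
  | .acc => β
  | .reg _ => Unit

theorem Alph.finite (α β : Type) {R : Type} [Finite α] [Finite β] (k : Stk R) :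
    Finite (Alph α β k) := by
  cases k <;> dsimp only [Alph] <;> infer_instance

variable {α β R : Type}

/-- The stacks with given contents, where registers contain numbers. -/
def st (w v : List α) (o a : List β) (ρ : R → ℕ) : ∀ k : Stk R, List (Alph α β k)
  | .inp => w
  | .rev => v
  | .out => o
  | .acc => a
  | .reg r => List.replicate (ρ r) ()

section

variable [DecidableEq R] (w v w' : List α) (o a o' : List β) (ρ : R → ℕ)

theorem update_inp : update (st w v o a ρ) .inp w' = st w' v o a ρ := by
  funext k
  by_cases h : k = .inp
  · subst h; exact update_self ..
  · rw [update_of_ne h]; cases k <;> first | rfl | exact absurd rfl h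

theorem update_rev : update (st w v o a ρ) .rev w' = st w w' o a ρ := by
  funext k
  by_cases h : k = .rev
  · subst h; exact update_self ..
  · rw [update_of_ne h]; cases k <;> first | rfl | exact absurd rfl h

theorem update_out : update (st w v o a ρ) .out o' = st w v o' a ρ := by
  funext k
  by_cases h : k = .out
  · subst h; exact update_self ..
  · rw [update_of_ne h]; cases k <;> first | rfl | exact absurd rfl h

theorem update_acc : update (st w v o a ρ) .acc o' = st w v o o' ρ := by
  funext k
  by_cases h : k = .acc
  · subst h; exact update_self ..
  · rw [update_of_ne h]; cases k <;> first | rfl | exact absurd rfl h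

theorem update_reg (r : R) (n : ℕ) :
    update (st w v o a ρ) (.reg r) (List.replicate n ()) = st w v o a (update ρ r n) := by
  funext k
  by_cases h : k = .reg r
  · subst h
    rw [update_self]
    simp only [st, update_self]
  · rw [update_of_ne h]
    cases k with
    | reg r' => simp only [st, update_of_ne (fun h' => h (congrArg Stk.reg h') : r' ≠ r)]
    | _ => rfl

variable {w v o a ρ}

theorem ExecLE.push_reg (r : R) :
    ExecLE (.push (.reg r) ()) (st w v o a ρ) (st w v o a (update ρ r (ρ r + 1))) 1 := by
  rw [← update_reg, List.replicate_succ]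
  exact ExecLE.push (Γ := Alph α β) (.reg r) () (st w v o a ρ)

theorem ExecLE.push_acc (b : β) :
    ExecLE (.push .acc b) (st w v o a ρ) (st w v o (b :: a) ρ) 1 := by
  rw [← update_acc w v o a (b :: a)]
  exact ExecLE.push (Γ := Alph α β) .acc b (st w v o a ρ)

theorem ExecLE.push_out (b : β) :
    ExecLE (.push .out b) (st w v o a ρ) (st w v (b :: o) a ρ) 1 := by
  rw [← update_out w v o a (b :: o)]
  exact ExecLE.push (Γ := Alph α β) .out b (st w v o a ρ)

theorem ExecLE.push_inp (b : α) :
    ExecLE (.push .inp b) (st w v o a ρ) (st (b :: w) v o a ρ) 1 := by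
  rw [← update_inp w v (b :: w) o a]
  exact ExecLE.push (Γ := Alph α β) .inp b (st w v o a ρ)

theorem ExecLE.push_rev (b : α) :
    ExecLE (.push .rev b) (st w v o a ρ) (st w (b :: v) o a ρ) 1 := by
  rw [← update_rev w v (b :: v) o a]
  exact ExecLE.push (Γ := Alph α β) .rev b (st w v o a ρ)

/-- A loop over a register, where `X t` describes the stacks after `t` rounds. -/
theorem ExecLE.loop_reg {i : R} {f : Unit → Cmd (Alph α β)} (n : ℕ) {T : ℕ}
    (a : ℕ → List β) (ρ : ℕ → R → ℕ) (hρ : ∀ t ≤ n, ρ t i = n - t)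
    (hf : ∀ t < n, ExecLE (f ()) (st w v o (a t) (update (ρ t) i (n - t - 1)))
      (st w v o (a (t + 1)) (ρ (t + 1))) T) :
    ExecLE (.loop (.reg i) f) (st w v o (a 0) (ρ 0)) (st w v o (a n) (ρ n))
      (n * (T + 1) + 1) := by
  have := ExecLE.loop (Γ := Alph α β) (k := .reg i) (f := f) (T := T) (List.replicate n ())
    (fun t => st w v o (a t) (ρ t)) (fun t ht => by
      rw [List.length_replicate] at ht
      simp [st, hρ t ht]) (fun t ht => by
      rw [List.length_replicate] at ht
      rw [List.drop_replicate, update_reg, Nat.sub_add_eq]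
      exact hf t ht)
  simpa only [List.length_replicate] using this

end

/-- Generators of strings over `β`, depending on a word over `α` and on registers. -/
inductive Gen (α β R : Type) : Type
  | emit (l : List β) : Gen α β R
  | seq (c d : Gen α β R) : Gen α β R
  /-- As many rounds as the value of the register `i`; the register `j` counts the rounds before
  the current one, and `i` those after it. -/
  | loop (i j : R) (c : Gen α β R) : Gen α β R
  | ifZero (i : R) (c d : Gen α β R) : Gen α β R
  | word (g : α → List β) : Gen α β R

namespace Gen

variable [DecidableEq R]

/-- The registers in a round of a loop. -/
def round (ρ : R → ℕ) (i j : R) (t : ℕ) : R → ℕ := update (update ρ i (ρ i - 1 - t)) j t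

/-- The string generated. -/
def den (w : List α) : Gen α β R → (R → ℕ) → List β
  | emit l, _ => l
  | seq c d, ρ => c.den w ρ ++ d.den w ρ
  | loop i j c, ρ => (List.range (ρ i)).flatMap fun t => c.den w (round ρ i j t)
  | ifZero i c d, ρ => if ρ i = 0 then c.den w ρ else d.den w ρ
  | word g, _ => w.flatMap g

/-- Every loop counter belongs to `Z` and is not in use. -/
def Ok : Gen α β R → Finset R → Prop
  | emit _, _ => True
  | seq c d, Z => c.Ok Z ∧ d.Ok Z
  | loop i j c, Z => i ≠ j ∧ j ∈ Z ∧ c.Ok ((Z.erase i).erase j)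
  | ifZero _ c d, Z => c.Ok Z ∧ d.Ok Z
  | word _, _ => True

instance decidableOk : (c : Gen α β R) → (Z : Finset R) → Decidable (c.Ok Z)
  | emit _, _ => inferInstanceAs (Decidable True)
  | seq c d, Z =>
    have := decidableOk c Z
    have := decidableOk d Z
    inferInstanceAs (Decidable (_ ∧ _))
  | loop _ _ c, _ =>
    have := decidableOk c
    inferInstanceAs (Decidable (_ ∧ _ ∧ _))
  | ifZero _ c d, Z =>
    have := decidableOk c Z
    have := decidableOk d Z
    inferInstanceAs (Decidable (_ ∧ _))
  | word _, _ => inferInstanceAs (Decidable True)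

/-- The program that writes a given string. -/
def emitCmd : List β → Cmd (K := Stk R) (Alph α β)
  | [] => .skip
  | b :: l => .seq (.push .acc b) (emitCmd l)

/-- The program of a generator; it writes to the accumulator. -/
def cmd : Gen α β R → Cmd (K := Stk R) (Alph α β)
  | emit l => emitCmd l
  | seq c d => .seq c.cmd d.cmd
  | loop i j c => .seq (.loop (.reg i) fun _ => .seq c.cmd (.push (.reg j) ()))
      (.loop (.reg j) fun _ => .push (.reg i) ())
  | ifZero i c d => .ifEmpty (.reg i) c.cmd d.cmd
  | word g => .seq (.loop .inp fun a => .seq (emitCmd (g a)) (.push .rev a))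
      (.loop .rev fun a => .push .inp a)

open Polynomial in
/-- A bound of the running time, as a polynomial in a bound of the registers and the length of the
word. -/
noncomputable def bound [Fintype α] : Gen α β R → ℕ[X]
  | emit l => C (l.length + 1)
  | seq c d => c.bound + d.bound
  | loop _ _ c => (X * (c.bound + 1 + 1) + 1) + (X * (1 + 1) + 1)
  | ifZero _ c d => c.bound + d.bound + 1
  | word g => (X * (C (∑ a, ((g a).length + 1)) + 1 + 1) + 1) + (X * (1 + 1) + 1)

variable {w v : List α} {o a : List β} {ρ : R → ℕ}

theorem exec_emitCmd (l : List β) :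
    ExecLE (emitCmd l) (st w v o a ρ) (st w v o (l.reverse ++ a) ρ) (l.length + 1) := by
  induction l generalizing a with
  | nil => exact ExecLE.skip _
  | cons b l ih =>
    have := ExecLE.seq (ExecLE.push_acc (w := w) (v := v) (o := o) (a := a) (ρ := ρ) b)
      (ih (a := b :: a))
    simp only [List.reverse_cons, List.append_assoc, List.singleton_append, List.length_cons]
    exact this.mono (by omega)

/-- Reading the word leaves it reversed on `rev`; moving it back restores the input, so that it can
be read again. -/
theorem exec_unload (o a : List β) (ρ : R → ℕ) :
    ExecLE (.loop .rev fun b => .push .inp b) (st [] w.reverse o a ρ) (st w [] o a ρ)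
      (w.length * (1 + 1) + 1) := by
  have := ExecLE.loop (Γ := Alph α β) (k := Stk.rev (R := R)) (f := fun b => .push .inp b) (T := 1)
    w.reverse (fun t => st (w.reverse.take t).reverse (w.reverse.drop t) o a ρ)
    (fun t ht => rfl) (fun t ht => by
      rw [update_rev, List.take_succ_eq_append_getElem ht, List.reverse_append]
      exact ExecLE.push_inp _)
  simpa only [List.length_reverse, List.take_zero, List.reverse_nil, List.drop_zero,
    List.take_of_length_le (List.length_reverse (as := w)).le, List.reverse_reverse,
    List.drop_of_length_le (List.length_reverse (as := w)).le] using this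

theorem exec_word {f : α → Cmd (K := Stk R) (Alph α β)} {g : α → List β} {T : ℕ}
    (hf : ∀ w v a b, ExecLE (f b) (st w v o a ρ) (st w (b :: v) o ((g b).reverse ++ a) ρ) T) :
    ExecLE (.loop .inp f) (st w [] o a ρ) (st [] w.reverse o ((w.flatMap g).reverse ++ a) ρ)
      (w.length * (T + 1) + 1) := by
  have := ExecLE.loop (Γ := Alph α β) (k := Stk.inp (R := R)) (f := f) (T := T) w
    (fun t => st (w.drop t) (w.take t).reverse o (((w.take t).flatMap g).reverse ++ a) ρ)
    (fun t ht => rfl) (fun t ht => by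
      rw [update_inp, List.take_succ_eq_append_getElem ht, List.reverse_append,
        List.flatMap_append, List.reverse_append, List.append_assoc]
      simpa using hf _ _ _ _)
  simpa using this

/-- Two invariants pass into loop bodies: the counters still available are `0`, and one number `B`
bounds all registers. The second survives because `i` and `j` together stay below the initial value
of `i`; so the polynomial of the body is evaluated at the same `B` in every round. The second loop
moves `j` back to `i` and restores the registers. -/
theorem exec [Fintype α] {B : ℕ} (c : Gen α β R) (Z : Finset R) (hc : c.Ok Z)
    (hZ : ∀ r ∈ Z, ρ r = 0) (hB : ∀ r, ρ r ≤ B) (hw : w.length ≤ B) :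
    ExecLE c.cmd (st w [] o a ρ) (st w [] o ((c.den w ρ).reverse ++ a) ρ) (c.bound.eval B) := by
  induction c generalizing Z ρ a with
  | emit l => simpa [bound, cmd, den] using exec_emitCmd l
  | seq c d ihc ihd =>
    simp only [den, List.reverse_append, List.append_assoc, bound, Polynomial.eval_add]
    exact (ihc Z hc.1 hZ hB).seq (ihd Z hc.2 hZ hB)
  | loop i j c ih =>
    obtain ⟨hij, hj, hc⟩ := hc
    have hj0 : ρ j = 0 := hZ j hj
    have h₁ := ExecLE.loop_reg (w := w) (v := []) (o := o) (i := i) (T := c.bound.eval B + 1)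
      (f := fun _ => .seq c.cmd (.push (.reg j) ())) (ρ i)
      (fun t => ((List.range t).flatMap fun t => c.den w (round ρ i j t)).reverse ++ a)
      (fun t => update (update ρ i (ρ i - t)) j t) (fun t ht => by simp [hij])
      (fun t ht => by
        have e₁ : update (update (update ρ i (ρ i - t)) j t) i (ρ i - t - 1) = round ρ i j t := by
          rw [update_comm hij.symm, update_idem, round, Nat.sub_right_comm]
        have e₂ : update (update ρ i (ρ i - (t + 1))) j (t + 1) =
            update (round ρ i j t) j (round ρ i j t j + 1) := by
          simp only [round, update_idem, update_self]
          congr 2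
          omega
        rw [e₁, e₂, List.range_succ, List.flatMap_append, List.reverse_append, List.append_assoc]
        simp only [List.flatMap_cons, List.flatMap_nil, List.append_nil]
        refine (ih ((Z.erase i).erase j) hc ?_ ?_).seq (ExecLE.push_reg j)
        · intro r hr
          simp only [Finset.mem_erase] at hr
          simp [round, hr.1, hr.2.1, hZ r hr.2.2]
        · intro r
          have := hB i
          have := hB r
          simp only [round, update_apply]
          split_ifs <;> omega)
    have h₂ := ExecLE.loop_reg (w := w) (v := []) (o := o) (i := j) (T := 1) (f := fun _ => .push (.reg i) ())
      (ρ i) (fun _ => ((List.range (ρ i)).flatMap fun t => c.den w (round ρ i j t)).reverse ++ a)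
      (fun t => update (update ρ i t) j (ρ i - t)) (fun t ht => by simp)
      (fun t ht => by
        have e₁ : update (update ρ i (t + 1)) j (ρ i - (t + 1)) =
            update (update (update ρ i t) j (ρ i - t - 1)) i
              (update (update ρ i t) j (ρ i - t - 1) i + 1) := by
          rw [update_comm hij.symm, update_of_ne hij, update_self, update_idem]
          rfl
        rw [e₁, update_idem]
        exact ExecLE.push_reg i)
    simp only [Nat.sub_zero, Nat.sub_self, update_eq_self, List.range_zero, List.flatMap_nil,
      List.reverse_nil, List.nil_append] at h₁ h₂
    have e : update ρ j 0 = ρ := update_eq_self_iff.2 hj0.symm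
    rw [e] at h₁ h₂
    refine (h₁.seq h₂).mono ?_
    simp only [bound, Polynomial.eval_add, Polynomial.eval_mul, Polynomial.eval_X,
      Polynomial.eval_one]
    have := hB i
    gcongr
  | ifZero i c d ihc ihd =>
    simp only [den, bound, Polynomial.eval_add, Polynomial.eval_one]
    split_ifs with h
    · refine (ExecLE.if_nil ?_ (ihc Z hc.1 hZ hB)).mono (by omega)
      simp [st, h]
    · refine (ExecLE.if_cons ?_ (ihd Z hc.2 hZ hB)).mono (by omega)
      simp [st, h]
  | word g =>
    have h₁ := exec_word (w := w) (a := a) (o := o) (ρ := ρ) (g := g)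
      (f := fun b => .seq (emitCmd (g b)) (.push .rev b))
      (T := ∑ a, ((g a).length + 1) + 1) (fun w v a b =>
        (((exec_emitCmd (g b)).mono (Finset.single_le_sum (f := fun a => (g a).length + 1)
          (fun _ _ => Nat.zero_le _) (Finset.mem_univ b))).seq (ExecLE.push_rev b)))
    refine (h₁.seq (exec_unload o _ ρ)).mono ?_
    simp only [bound, Polynomial.eval_add, Polynomial.eval_mul, Polynomial.eval_X,
      Polynomial.eval_one, Polynomial.eval_C]
    gcongr

end Gen
end StackProg

/-! ### Setting up registers and running a generator -/

namespace StackProg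

open Function

/-- A step pushes at most one symbol, so a time bound also bounds the length of what is written. -/
theorem Exec.length_le {K : Type} [DecidableEq K] {Γ : K → Type} {c : Cmd Γ}
    {S S' : ∀ k, List (Γ k)} {t : ℕ} (h : Exec c S S' t) (k : K) :
    (S' k).length ≤ (S k).length + t := by
  induction h with
  | push k' a S =>
    by_cases h : k = k'
    · subst h; simp
    · simp [update_of_ne h]
  | @loop_cons k' f S S' S'' a l m n h hc hd ihc ihd =>
    have : (update S k' l k).length ≤ (S k).length := by
      by_cases h' : k = k'
      · subst h'; simp [h]
      · simp [update_of_ne h']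
    omega
  | _ => omega

/-! ### Arithmetic on unary registers -/

variable {α β R : Type} [DecidableEq R]

/-- The registers `ρ`, with `n` times the multiplicity in `L` added. -/
def addCount (ρ : R → ℕ) (n : ℕ) (L : List R) : R → ℕ := fun r => ρ r + n * L.count r

/-- Increment the registers in `L`. -/
def incs : List R → Cmd (K := Stk R) (Alph α β)
  | [] => .skip
  | r :: L => .seq (.push (.reg r) ()) (incs L)

/-- Count the register `i` down to `0`, incrementing the registers in `L` in every round. -/
def drain (i : R) (L : List R) : Cmd (K := Stk R) (Alph α β) := .loop (.reg i) fun _ => incs L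

section

variable {w v : List α} {o a : List β} {ρ : R → ℕ}

theorem exec_incs (L : List R) :
    ExecLE (incs L) (st w v o a ρ) (st w v o a (addCount ρ 1 L)) (L.length + 1) := by
  induction L generalizing ρ with
  | nil =>
    have : addCount ρ 1 [] = ρ := by funext r; simp [addCount]
    rw [this]
    exact ExecLE.skip _
  | cons r L ih =>
    have := ExecLE.seq (ExecLE.push_reg r) (ih (ρ := update ρ r (ρ r + 1)))
    have e : addCount (update ρ r (ρ r + 1)) 1 L = addCount ρ 1 (r :: L) := by
      funext r'
      by_cases h : r' = r
      · subst h; simp [addCount]; omega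
      · simp [addCount, h, Ne.symm h]
    rw [e] at this
    exact this.mono (by simp; omega)

theorem exec_drain {i : R} {L : List R} (hi : i ∉ L) :
    ExecLE (drain i L) (st w v o a ρ) (st w v o a (update (addCount ρ (ρ i) L) i 0))
      (ρ i * (L.length + 1 + 1) + 1) := by
  have := ExecLE.loop_reg (w := w) (v := v) (o := o) (i := i) (T := L.length + 1)
    (f := fun _ => incs L) (ρ i) (fun _ => a)
    (fun t => update (addCount ρ t L) i (ρ i - t)) (fun t ht => by simp)
    (fun t ht => by
      have e : update (addCount ρ (t + 1) L) i (ρ i - (t + 1)) =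
          addCount (update (update (addCount ρ t L) i (ρ i - t)) i (ρ i - t - 1)) 1 L := by
        funext r
        by_cases h : r = i
        · subst h; simp [addCount, List.count_eq_zero_of_not_mem hi]; omega
        · simp [addCount, h]; ring
      rw [e]
      exact exec_incs L)
  have e : update (addCount ρ 0 L) i (ρ i - 0) = ρ := by
    rw [update_eq_iff]
    simp [addCount]
  simp only [e, Nat.sub_self] at this
  exact this

theorem exec_drain_nil (i : R) :
    ExecLE (drain i []) (st w v o a ρ) (st w v o a (update ρ i 0)) (ρ i * 2 + 1) := by
  have := exec_drain (w := w) (v := v) (o := o) (a := a) (ρ := ρ) (i := i) (L := []) (by simp)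
  have e : addCount ρ (ρ i) [] = ρ := by funext r; simp [addCount]
  simp only [e] at this
  exact this

/-- Clear the registers in `L`. -/
def clear : List R → Cmd (K := Stk R) (Alph α β)
  | [] => .skip
  | r :: L => .seq (drain r []) (clear L)

theorem exec_clear (L : List R) {B : ℕ} (hB : ∀ r, ρ r ≤ B) :
    ExecLE (clear L) (st w v o a ρ) (st w v o a (fun r => if r ∈ L then 0 else ρ r))
      (L.length * (B * 2 + 1) + 1) := by
  induction L generalizing ρ with
  | nil => simpa [clear] using ExecLE.skip _
  | cons r L ih =>
    have := (exec_drain_nil (w := w) (v := v) (o := o) (a := a) (ρ := ρ) r).seq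
      (ih (ρ := update ρ r 0) (fun r' => by
        have := hB r'
        rw [update_apply]
        split_ifs <;> omega))
    have e : (fun r' => if r' ∈ L then 0 else update ρ r 0 r') =
        fun r' => if r' ∈ r :: L then 0 else ρ r' := by
      funext r'
      by_cases h : r' = r
      · subst h; simp
      · simp [h]
    rw [e] at this
    refine this.mono ?_
    have := hB r
    simp only [List.length_cons, Nat.add_mul]
    omega

theorem exec_copy_out :
    ExecLE (.loop .acc fun b => .push .out b) (st w v [] a ρ) (st w v a.reverse [] ρ)
      (a.length * 2 + 1) := by
  have := ExecLE.loop (Γ := Alph α β) (k := Stk.acc (R := R)) (f := fun b => .push .out b) (T := 1)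
    a (fun t => st w v (a.take t).reverse (a.drop t) ρ)
    (fun t ht => rfl) (fun t ht => by
      rw [update_acc, List.take_succ_eq_append_getElem ht, List.reverse_append]
      exact ExecLE.push_out _)
  simpa using this

theorem exec_drop_inp :
    ExecLE (.loop .inp fun _ => .skip) (st w v o a ρ) (st [] v o a ρ) (w.length * 2 + 1) := by
  have := ExecLE.loop (Γ := Alph α β) (k := Stk.inp (R := R)) (f := fun _ => .skip) (T := 1)
    w (fun t => st (w.drop t) v o a ρ)
    (fun t ht => rfl) (fun t ht => by
      rw [update_inp]
      exact ExecLE.skip _)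
  simpa using this

theorem exec_load (L : List R) :
    ExecLE (.loop .inp fun b => .seq (incs L) (.push .rev b)) (st w [] o a ρ)
      (st [] w.reverse o a (addCount ρ w.length L)) (w.length * (L.length + 1 + 1 + 1) + 1) := by
  have := ExecLE.loop (Γ := Alph α β) (k := Stk.inp (R := R))
    (f := fun b => .seq (incs L) (.push .rev b)) (T := L.length + 1 + 1)
    w (fun t => st (w.drop t) (w.take t).reverse o a (addCount ρ t L))
    (fun t ht => rfl) (fun t ht => by
      have e : addCount ρ (t + 1) L = addCount (addCount ρ t L) 1 L := by
        funext r; simp only [addCount]; ring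
      rw [update_inp, List.take_succ_eq_append_getElem ht, List.reverse_append, e]
      exact (exec_incs L).seq (ExecLE.push_rev _))
  have e : addCount ρ 0 L = ρ := by funext r; simp [addCount]
  simpa [e] using this

/-- Multiply the register `x` by the register `m`. -/
def mulCmd (m x y t : R) : Cmd (K := Stk R) (Alph α β) :=
  .seq (.loop (.reg x) fun _ => .seq (drain m [y, t]) (drain t [m])) (drain y [x])

/-- Each unit of `x` adds `m` to `y`; the second copy in `t` serves to restore `m`. At the end `y`
is moved to `x`. -/
theorem exec_mulCmd {m x y t : R} (hd : [m, x, y, t].Nodup) (hy : ρ y = 0) (ht : ρ t = 0) :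
    ExecLE (mulCmd m x y t) (st w v o a ρ) (st w v o a (update ρ x (ρ x * ρ m)))
      ((ρ x * (ρ m * 4 + 1 + (ρ m * 3 + 1) + 1) + 1) + (ρ x * ρ m * 3 + 1)) := by
  simp only [List.nodup_cons, List.mem_cons, List.not_mem_nil, or_false, not_or] at hd
  obtain ⟨⟨hmx, hmy, hmt⟩, ⟨hxy, hxt⟩, hyt, -⟩ := hd
  have h₁ := ExecLE.loop_reg (w := w) (v := v) (o := o) (i := x)
    (T := ρ m * 4 + 1 + (ρ m * 3 + 1)) (f := fun _ => .seq (drain m [y, t]) (drain t [m]))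
    (ρ x) (fun _ => a) (fun s => update (update ρ y (s * ρ m)) x (ρ x - s))
    (fun s hs => by simp) (fun s hs => by
      have h₁ := exec_drain (α := α) (β := β) (w := w) (v := v) (o := o) (a := a)
        (ρ := update (update (update ρ y (s * ρ m)) x (ρ x - s)) x (ρ x - s - 1))
        (i := m) (L := [y, t]) (by simp [hmy, hmt])
      set ρ₁ := update (addCount (update (update (update ρ y (s * ρ m)) x (ρ x - s)) x
        (ρ x - s - 1)) (update (update (update ρ y (s * ρ m)) x (ρ x - s)) x (ρ x - s - 1) m)
        [y, t]) m 0 with hρ₁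
      have h₂ := exec_drain (α := α) (β := β) (w := w) (v := v) (o := o) (a := a)
        (ρ := ρ₁) (i := t) (L := [m]) (by simp [Ne.symm hmt])
      have e : update (addCount ρ₁ (ρ₁ t) [m]) t 0 =
          update (update ρ y ((s + 1) * ρ m)) x (ρ x - (s + 1)) := by
        funext r
        simp only [hρ₁, addCount, update_apply, List.count_cons, List.count_nil, beq_iff_eq]
        by_cases hrt : r = t
        · subst hrt; simp [Ne.symm hxt, Ne.symm hyt, ht]
        by_cases hrm : r = m
        · subst hrm; simp [*, Ne.symm hmt, Ne.symm hyt, Ne.symm hxt]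
        by_cases hrx : r = x
        · subst hrx; simp [*, Ne.symm hxy, Ne.symm hxt]; omega
        by_cases hry : r = y
        · subst hry; simp [*, Ne.symm hyt]; ring
        · simp [*, Ne.symm hrt, Ne.symm hry, Ne.symm hrm]
      rw [e] at h₂
      refine (h₁.seq h₂).mono ?_
      simp [addCount, *, Ne.symm hmt, Ne.symm hyt, Ne.symm hxt])
  have h₂ := exec_drain (α := α) (β := β) (w := w) (v := v) (o := o) (a := a)
    (ρ := update (update ρ y (ρ x * ρ m)) x (ρ x - ρ x)) (i := y) (L := [x]) (by simp [Ne.symm hxy])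
  have e : update (update ρ y (0 * ρ m)) x (ρ x - 0) = ρ := by
    rw [Nat.zero_mul, Nat.sub_zero, ← hy, update_eq_self, update_eq_self]
  have e' : update (addCount (update (update ρ y (ρ x * ρ m)) x (ρ x - ρ x))
      (update (update ρ y (ρ x * ρ m)) x (ρ x - ρ x) y) [x]) y 0 =
      update ρ x (ρ x * ρ m) := by
    funext r
    by_cases hry : r = y
    · subst hry; simp [Ne.symm hxy, hy]
    by_cases hrx : r = x
    · subst hrx; simp [addCount, *, Ne.symm hxy]
    · simp [addCount, *, Ne.symm hrx]
  rw [e] at h₁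
  rw [e'] at h₂
  refine (h₁.seq h₂).mono ?_
  simp [Ne.symm hxy]

/-- Multiply `x` by the `e`-th power of `m`. -/
def powCmd (m x y t : R) : ℕ → Cmd (K := Stk R) (Alph α β)
  | 0 => .skip
  | e + 1 => .seq (powCmd m x y t e) (mulCmd m x y t)

open Polynomial in
-- The exponent is fixed with the program, so the times of the `e` multiplications add up to a
-- polynomial in `n`.
theorem exec_powCmd {m x y t : R} (hd : [m, x, y, t].Nodup) (p : ℕ[X]) (e : ℕ) :
    ∃ q : ℕ[X], ∀ (n : ℕ) (w v : List α) (o a : List β) (ρ : R → ℕ), ρ y = 0 → ρ t = 0 →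
      ρ x = 1 → ρ m = p.eval n →
      ExecLE (powCmd m x y t e) (st w v o a ρ) (st w v o a (update ρ x (p.eval n ^ e)))
        (q.eval n) := by
  have hd' := hd
  simp only [List.nodup_cons, List.mem_cons, List.not_mem_nil, or_false, not_or] at hd'
  obtain ⟨⟨hmx, hmy, hmt⟩, ⟨hxy, hxt⟩, hyt, -⟩ := hd'
  induction e with
  | zero =>
    refine ⟨1, fun n w v o a ρ hy ht hx hm => ?_⟩
    rw [pow_zero, ← hx, update_eq_self, eval_one]
    exact ExecLE.skip _
  | succ e ih =>
    obtain ⟨q, hq⟩ := ih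
    refine ⟨q + ((p ^ e * (p * 4 + 1 + (p * 3 + 1) + 1) + 1) + (p ^ e * p * 3 + 1)),
      fun n w v o a ρ hy ht hx hm => ?_⟩
    have h := exec_mulCmd (w := w) (v := v) (o := o) (a := a)
      (ρ := update ρ x (p.eval n ^ e)) hd
      (by rw [update_of_ne (Ne.symm hxy), hy]) (by rw [update_of_ne (Ne.symm hxt), ht])
    rw [update_idem, update_self, update_of_ne hmx, hm, ← pow_succ] at h
    refine ((hq n w v o a ρ hy ht hx hm).seq h).mono (le_of_eq ?_)
    simp [pow_succ]

/-- Run a generator, where the registers are set to constants, multiples of the length `n` of the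
input, and multiples of `(n + c) ^ e`. -/
def runCmd (m x y t : R) (c e : ℕ) (L₀ L₁ L₂ L : List R) (G : Gen α β R) :
    Cmd (K := Stk R) (Alph α β) :=
  .seq (.seq (.loop .inp fun b => .seq (incs (m :: L₁)) (.push .rev b))
    (.loop .rev fun b => .push .inp b)) <|
  .seq (incs (x :: (List.replicate c m ++ L₀))) <|
  .seq (powCmd m x y t e) <|
  .seq (drain x L₂) <|
  .seq (drain m []) <|
  .seq G.cmd <|
  .seq (clear L) <|
  .seq (.loop .inp fun _ => .skip) (.loop .acc fun b => .push .out b)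

/-- The registers set by `runCmd`. -/
def regs (c e : ℕ) (L₀ L₁ L₂ : List R) (n : ℕ) : R → ℕ :=
  fun r => L₀.count r + n * L₁.count r + (n + c) ^ e * L₂.count r

open Polynomial in
theorem exec_runCmd [Fintype α] [Fintype R] {m x y t : R} (hd : [m, x, y, t].Nodup) (c e : ℕ)
    (L₀ L₁ L₂ : List R) (G : Gen α β R) (Z : Finset R) (hG : G.Ok Z)
    (hZ : ∀ r ∈ Z, r ∉ L₀ ∧ r ∉ L₁ ∧ r ∉ L₂) (hmZ : ∀ r ∈ [m, x, y, t], r ∈ Z) :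
    ∃ q : ℕ[X], ∀ w : List α,
      ExecLE (runCmd m x y t c e L₀ L₁ L₂ Finset.univ.toList G) (st w [] [] [] fun _ => 0)
        (st [] [] (G.den w (regs c e L₀ L₁ L₂ w.length)) [] fun _ => 0) (q.eval w.length) := by
  obtain ⟨q, hq⟩ := exec_powCmd (α := α) (β := β) hd (X + C c) e
  simp only [List.nodup_cons, List.mem_cons, List.not_mem_nil, or_false, not_or] at hd
  obtain ⟨⟨hmx, hmy, hmt⟩, ⟨hxy, hxt⟩, hyt, -⟩ := hd
  have hZ' : ∀ r ∈ Z, L₀.count r = 0 ∧ L₁.count r = 0 ∧ L₂.count r = 0 := fun r hr => by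
    simpa only [List.count_eq_zero] using hZ r hr
  obtain ⟨hm₀, hm₁, hm₂⟩ := hZ' m (hmZ m (by simp))
  obtain ⟨hx₀, hx₁, hx₂⟩ := hZ' x (hmZ x (by simp))
  obtain ⟨hy₀, hy₁, -⟩ := hZ' y (hmZ y (by simp))
  obtain ⟨ht₀, ht₁, -⟩ := hZ' t (hmZ t (by simp))
  set P : ℕ[X] := C L₀.length + X * C L₁.length + (X + C c) ^ e * C L₂.length with hP
  set B : ℕ[X] := P + X with hB
  refine ⟨((X * C ((m :: L₁).length + 1 + 1 + 1) + 1) + (X * (1 + 1) + 1)) +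
    (C ((x :: (List.replicate c m ++ L₀)).length + 1) + (q + (((X + C c) ^ e *
      C (L₂.length + 1 + 1) + 1) + (((X + C c) * 2 + 1) + (G.bound.comp B + (
    (C (Finset.univ : Finset R).toList.length * (B * 2 + 1) + 1) + ((X * 2 + 1) +
      (G.bound.comp B * 2 + 1)))))))), fun w => ?_⟩
  have h₁ := (exec_load (w := w) (o := []) (a := ([] : List β)) (ρ := fun _ => 0) (m :: L₁)).seq
    (Gen.exec_unload [] _ _)
  set n := w.length with hn
  set ρ₁ := addCount (fun _ => 0) n (m :: L₁)
  have h₂ := exec_incs (α := α) (β := β) (w := w) (v := []) (o := []) (a := []) (ρ := ρ₁)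
    (x :: (List.replicate c m ++ L₀))
  set ρ₂ := addCount ρ₁ 1 (x :: (List.replicate c m ++ L₀))
  -- Now `m` contains `n + c` and `x` contains `1`, ready for the power.
  have hρ₂ : ρ₂ = update (update (fun r => L₀.count r + n * L₁.count r) m (n + c)) x 1 := by
    funext r
    by_cases hrx : r = x
    · subst hrx
      simp [ρ₂, ρ₁, addCount, hx₀, hx₁,
        hmx, List.count_replicate]
    by_cases hrm : r = m
    · subst hrm
      simp [ρ₂, ρ₁, addCount, hm₀, hm₁,
        hmx, Ne.symm hmx]
    · simp [ρ₂, ρ₁, addCount, hrx, hrm, Ne.symm hrx, Ne.symm hrm, List.count_replicate]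
      ring
  have h₃ := hq n w [] [] [] ρ₂
    (by simp [hρ₂, Ne.symm hxy, Ne.symm hmy, hy₀, hy₁])
    (by simp [hρ₂, Ne.symm hxt, Ne.symm hmt, ht₀, ht₁])
    (by simp [hρ₂]) (by simp [hρ₂, hmx])
  have hpc : (X + C c : ℕ[X]).eval n = n + c := by simp
  rw [hpc] at h₃
  set ρ₃ := update ρ₂ x ((n + c) ^ e)
  have h₄ := exec_drain (α := α) (β := β) (w := w) (v := []) (o := []) (a := []) (ρ := ρ₃)
    (List.count_eq_zero.1 hx₂)
  set ρ₄ := update (addCount ρ₃ (ρ₃ x) L₂) x 0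
  have h₅ := exec_drain_nil (α := α) (β := β) (w := w) (v := []) (o := []) (a := []) (ρ := ρ₄) m
  have hρ₅ : update ρ₄ m 0 = regs c e L₀ L₁ L₂ n := by
    funext r
    by_cases hrm : r = m
    · subst hrm; simp [regs, hm₀, hm₁, hm₂]
    by_cases hrx : r = x
    · subst hrx; simp [regs, hx₀, hx₁, hx₂, hrm, ρ₄]
    · simp [regs, ρ₄, ρ₃, hρ₂, addCount, hrm, hrx]
  have hρ₃ : ρ₃ x = (n + c) ^ e := by simp [ρ₃]
  have hρ₄ : ρ₄ m = n + c := by simp [ρ₄, ρ₃, hρ₂, addCount, hmx, hm₂]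
  rw [hρ₃] at h₄
  rw [hρ₄, hρ₅] at h₅
  have hPn : ∀ r, regs c e L₀ L₁ L₂ n r ≤ P.eval n := by
    intro r
    simp only [hP, eval_add, eval_mul, eval_C, eval_X, eval_pow, regs]
    gcongr <;> exact List.count_le_length
  have hBn : ∀ r, regs c e L₀ L₁ L₂ n r ≤ B.eval n := fun r =>
    (hPn r).trans (by simp [hB])
  have h₆ := G.exec (w := w) (o := []) (a := []) (ρ := regs c e L₀ L₁ L₂ n) (B := B.eval n) Z hG
    (fun r hr => by
      obtain ⟨hr₀, hr₁, hr₂⟩ := hZ' r hr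
      simp [regs, hr₀, hr₁, hr₂])
    hBn (by simp [hB, hn])
  -- This bounds the time of the final copy to the output, which also undoes the reversal in the
  -- accumulator.
  have hlen : ((G.den w (regs c e L₀ L₁ L₂ n)).reverse ++ []).length ≤ G.bound.eval (B.eval n) := by
    obtain ⟨s, hs, h⟩ := h₆
    have := h.length_le .acc
    simp only [st, List.length_nil, Nat.zero_add] at this
    omega
  have h₇ := exec_clear (α := α) (β := β) (w := w) (v := []) (o := [])
    (a := (G.den w (regs c e L₀ L₁ L₂ n)).reverse ++ []) (ρ := regs c e L₀ L₁ L₂ n)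
    Finset.univ.toList hBn
  have h₈ := exec_drop_inp (α := α) (β := β) (w := w) (v := []) (o := [])
    (a := (G.den w (regs c e L₀ L₁ L₂ n)).reverse ++ [])
    (ρ := fun r => if r ∈ Finset.univ.toList then 0 else regs c e L₀ L₁ L₂ n r)
  have h₉ := exec_copy_out (α := α) (β := β) (w := []) (v := [])
    (a := (G.den w (regs c e L₀ L₁ L₂ n)).reverse ++ [])
    (ρ := fun r => if r ∈ Finset.univ.toList then 0 else regs c e L₀ L₁ L₂ n r)
  have := h₁.seq (h₂.seq (h₃.seq (h₄.seq (h₅.seq (h₆.seq (h₇.seq (h₈.seq h₉)))))))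
  simp only [Finset.mem_toList, Finset.mem_univ, if_true, List.append_nil,
    List.reverse_reverse] at this hlen
  refine this.mono ?_
  simp only [eval_add, eval_mul, eval_C, eval_X, eval_pow, eval_one, eval_comp, eval_ofNat]
  gcongr

/-- Functions whose values are written by a generator are computable in polynomial time. -/
theorem gen_computableInPolyTime [Fintype α] [Finite β] [Fintype R] {δ : Type} {m x y t : R}
    (hd : [m, x, y, t].Nodup) (c e : ℕ)
    (L₀ L₁ L₂ : List R) (G : Gen α β R) (Z : Finset R) (hG : G.Ok Z)
    (hZ : ∀ r ∈ Z, r ∉ L₀ ∧ r ∉ L₁ ∧ r ∉ L₂) (hmZ : ∀ r ∈ [m, x, y, t], r ∈ Z)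
    (enc : δ → List β) (f : List α → δ)
    (hf : ∀ w, enc (f w) = G.den w (regs c e L₀ L₁ L₂ w.length)) :
    Nonempty (Turing.TM2ComputableInPolyTime (id : List α → List α) enc f) := by
  obtain ⟨q, hq⟩ := exec_runCmd hd c e L₀ L₁ L₂ G Z hG hZ hmZ
  have := Stk.finite R
  have := Fintype.ofFinite (Stk R)
  have := Alph.finite α β (R := R)
  have h₁ : ∀ w, st w [] [] [] (fun _ => 0) = single (Γ := Alph α β (R := R)) .inp w := by
    intro w
    rw [single, ← update_inp []]
    congr 1
    funext k
    cases k <;> rfl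
  have h₂ : ∀ w, st [] [] w [] (fun _ => 0) = single (Γ := Alph α β (R := R)) .out w := by
    intro w
    rw [single, ← update_out _ _ []]
    congr 1
    funext k
    cases k <;> rfl
  refine computableInPolyTime (Γ := Alph α β (R := R)) (k₀ := .inp) (k₁ := .out) enc f
    (runCmd m x y t c e L₀ L₁ L₂ Finset.univ.toList G) q fun w => ?_
  rw [← h₁, ← h₂, hf]
  exact hq w

end

end StackProg

/-! ### The clause sets and the generator that writes them -/

namespace EPR

/-- An atomic formula: a predicate symbol with its arguments. -/
abbrev Atom := ℕ × List Term

/-- The literal of an atom with a given sign. -/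
def Atom.lit (A : Atom) (s : Bool) : Literal := ⟨s, A.1, A.2⟩

/-- The two clauses that express the equivalence of two atoms. -/
def equiv (A B : Atom) : ClauseSet := [[A.lit false, B.lit true], [A.lit true, B.lit false]]

/-- The variables number `p, …, p + k - 1`. -/
def vars (p k : ℕ) : List Term := (List.range k).map fun j => Term.var (p + j)

/-- What a Turing machine sees: a symbol, and a state code that depends on the position `i` of the
head, namely `code₀` if `i = 0` and `base + mul * i` otherwise. -/
structure Scan where
  sym : ℕ
  code₀ : ℕ
  base : ℕ
  mul : ℕ

/-- The state code at cell `i`. -/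
def Scan.code (x : Scan) (i : ℕ) : ℕ := if i = 0 then x.code₀ else x.base + x.mul * i

section

variable (N K : ℕ)

/-- The stack of `d + 1` pairs of configurations. -/
def stackAtom (d mode : ℕ) : Atom :=
  (d, vars 0 ((d + 1) * (2 * (N + 1))) ++ [Term.const mode])

/-- The stack of `d + 2` pairs of configurations, where the last configuration is a copy of the
first (for `b = 0`) or second (for `b = N + 1`) member of the pair before. -/
def pushAtom (d b mode : ℕ) : Atom :=
  (d + 1, vars 0 ((d + 1) * (2 * (N + 1))) ++ (vars ((d + 1) * (2 * (N + 1))) (N + 1) ++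
    (vars (d * (2 * (N + 1)) + b) (N + 1) ++ [Term.const mode])))

/-- A stack of `K + 1` pairs whose last pair consists of equal configurations. -/
def reflAtom (mode : ℕ) : Atom :=
  (K, vars 0 (K * (2 * (N + 1))) ++ (vars (K * (2 * (N + 1))) (N + 1) ++
    (vars (K * (2 * (N + 1))) (N + 1) ++ [Term.const mode])))

/-- A configuration with the symbol `a` in cell `i`, the state code `q`, and variables numbered
from `p` in the other cells. -/
def rowTerms (p i a q : ℕ) : List Term :=
  vars p i ++ (Term.const a :: (vars (p + (i + 1)) (N - 1 - i) ++ [Term.const q]))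

/-- A stack of `K + 1` pairs whose last pair belongs to the transition from `r.1` to `r.2`
at cell `i`. -/
def stepAtom (i : ℕ) (r : Scan × Scan) (mode : ℕ) : Atom :=
  (K, vars 0 (K * (2 * (N + 1))) ++
    (rowTerms N (K * (2 * (N + 1))) i r.1.sym (r.1.code i) ++
      (rowTerms N (K * (2 * (N + 1))) i r.2.sym (r.2.code i) ++ [Term.const mode])))

/-- The pair of the initial configuration and an arbitrary configuration with the state
code `0`. -/
def goalAtom (init : List ℕ) (mode : ℕ) : Atom :=
  (0, init.map Term.const ++ (vars 0 N ++ [Term.const 0, Term.const mode]))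

/-- The clauses that describe the reachability of a configuration with state code `0`. -/
def pathClauses (T : List (Scan × Scan)) (init : List ℕ) : ClauseSet :=
  [[(goalAtom N init 0).lit true], [(goalAtom N init 1).lit false]] ++
  ((List.range K).flatMap (fun d =>
    equiv (stackAtom N d 0) (pushAtom N d 0 0) ++
    (equiv (pushAtom N d 0 1) (pushAtom N d (N + 1) 0) ++
    equiv (pushAtom N d (N + 1) 1) (stackAtom N d 1))) ++
  (equiv (reflAtom N K 0) (reflAtom N K 1) ++
  (List.range N).flatMap fun i => T.flatMap fun r =>
    equiv (stepAtom N K i r 0) (stepAtom N K i r 1)))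

end

theorem vars_append (p k l : ℕ) : vars p k ++ vars (p + k) l = vars p (k + l) := by
  simp [vars, List.range_add, Nat.add_assoc]

/-- The generator writes variables pair by pair, while atoms list them in one run. -/
theorem flatMap_vars (n u : ℕ) :
    ((List.range n).flatMap fun e => vars (e * u) u) = vars 0 (n * u) := by
  induction n with
  | zero => simp [vars]
  | succ n ih =>
    rw [List.range_succ, List.flatMap_append, ih, Nat.succ_mul, ← vars_append]
    simp

end EPR

/-! ### Generators of literals and clauses -/

namespace StackProg

open EPR Function

/-- The registers of the generator. -/
inductive Reg where
  | aux₀ | aux₁ | aux₂ | aux₃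
  | cells | blanks | depth | width | width' | pair | pair'
  | d | f | i | j | z | z'
  deriving DecidableEq

namespace Reg

instance : Fintype Reg :=
  Fintype.ofList [aux₀, aux₁, aux₂, aux₃, cells, blanks, depth, width, width', pair, pair',
    d, f, i, j, z, z'] (by rintro (_ | _) <;> simp)

/-- The registers that are not set in the beginning. -/
def scratch : Finset Reg := {aux₀, aux₁, aux₂, aux₃, d, f, i, j, z, z'}

end Reg

namespace Gen

open Reg

variable {α : Type}

infixr:60 " ;; " => Gen.seq

/-- As many ticks as the value of `r`. -/
def ticks (r : Reg) : Gen α Symb Reg := loop r z (emit [Symb.tick])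

/-- As many ticks as `p` pairs of configurations have entries. -/
def pairs (p : Reg) : Gen α Symb Reg := loop p z (loop pair z' (emit [Symb.tick]))

/-- Variables for `n` places, numbered from the `p`-th pair on with an offset. -/
def block (n p : Reg) (off : Gen α Symb Reg) : Gen α Symb Reg :=
  loop n j (emit [Symb.var] ;; pairs p ;; off ;; ticks j)

/-- The variables of the first `n` pairs. -/
def stack (n : Reg) : Gen α Symb Reg := loop n f (block pair' f (emit []))

/-- A sign and a predicate symbol. -/
def head (s : Bool) (p : Reg) : Gen α Symb Reg :=
  emit [if s then Symb.pos else Symb.neg] ;; ticks p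

/-- A constant with fixed name. -/
def constant (c : ℕ) : Gen α Symb Reg := emit (Symb.const :: unary c)

/-- A loop alters the register that it counts down. A number that is read inside its own loop is
therefore kept twice: `pair'` drives the loop while `pair` is read in the body, and likewise `width`
and `width'`. -/
def stackLit (mode : ℕ) (s : Bool) : Gen α Symb Reg :=
  head s d ;; stack d ;; block pair' d (emit []) ;; constant mode

/-- The additional tick turns the predicate `d` into `d + 1`. The last block repeats variables of
the pair number `d`, from the offset `off` on. -/
def pushLit (off : Gen α Symb Reg) (mode : ℕ) (s : Bool) : Gen α Symb Reg :=
  head s d ;; emit [Symb.tick] ;; stack d ;; block pair' d (emit []) ;;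
  block width d (ticks pair) ;; block width d off ;; constant mode

def reflLit (mode : ℕ) (s : Bool) : Gen α Symb Reg :=
  head s depth ;; stack depth ;; block width depth (emit []) ;; block width depth (emit []) ;;
  constant mode

/-- A constant with the name `b + c * i`. -/
def stateConst (b c : ℕ) : Gen α Symb Reg := constant b ;; loop i z (emit (unary c))

/-- This runs inside the loop over `cells` with counter `i`, where `cells` contains the number of
cells to the right of cell `i`. -/
def row (x : Scan) : Gen α Symb Reg :=
  block i depth (emit []) ;; constant x.sym ;;
  block cells depth (ticks i ;; emit [Symb.tick]) ;;
  ifZero i (constant x.code₀) (stateConst x.base x.mul)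

def stepLit (r : Scan × Scan) (mode : ℕ) (s : Bool) : Gen α Symb Reg :=
  head s depth ;; stack depth ;; row r.1 ;; row r.2 ;; constant mode

def goalLit (sym : α → ℕ) (blank start : ℕ) (mode : ℕ) (s : Bool) : Gen α Symb Reg :=
  emit [if s then Symb.pos else Symb.neg] ;;
  word (fun a => Symb.const :: unary (sym a)) ;; loop blanks z (constant blank) ;;
  constant start ;; loop cells j (emit [Symb.var] ;; ticks j) ;; constant 0 ;; constant mode ;;
  emit [Symb.endClause]

def equivGen (A B : Bool → Gen α Symb Reg) : Gen α Symb Reg :=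
  A false ;; B true ;; emit [Symb.endClause] ;; A true ;; B false ;; emit [Symb.endClause]

def stepsGen : List (Scan × Scan) → Gen α Symb Reg
  | [] => emit []
  | r :: T => equivGen (stepLit r 0) (stepLit r 1) ;; stepsGen T

/-- The generator of `pathClauses`. -/
def pathGen (sym : α → ℕ) (blank start : ℕ) (T : List (Scan × Scan)) : Gen α Symb Reg :=
  goalLit sym blank start 0 true ;; goalLit sym blank start 1 false ;;
  loop depth d (equivGen (stackLit 0) (pushLit (emit []) 0) ;;
    equivGen (pushLit (emit []) 1) (pushLit (ticks width') 0) ;;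
    equivGen (pushLit (ticks width') 1) (stackLit 1)) ;;
  equivGen (reflLit 0) (reflLit 1) ;;
  loop cells i (stepsGen T)

theorem ok_stepsGen (T : List (Scan × Scan)) :
    (stepsGen T : Gen α Symb Reg).Ok ((scratch.erase cells).erase i) := by
  induction T with
  | nil => trivial
  | cons r T ih => exact ⟨of_decide_eq_true rfl, ih⟩

theorem ok_pathGen (sym : α → ℕ) (blank start : ℕ) (T : List (Scan × Scan)) :
    (pathGen sym blank start T).Ok scratch :=
  ⟨of_decide_eq_true rfl, of_decide_eq_true rfl, of_decide_eq_true rfl, of_decide_eq_true rfl,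
    by decide, by decide, ok_stepsGen T⟩

/-! ### The generator writes the encoded clause set -/

section

variable {w : List α} {ρ : Reg → ℕ}

theorem flatMap_replicate {β : Type} (n k : ℕ) (b : β) :
    ((List.range n).flatMap fun _ => List.replicate k b) = List.replicate (n * k) b := by
  induction n with
  | zero => simp
  | succ n ih => simp [List.range_succ, ih, Nat.succ_mul]

theorem round_of_ne {a b r : Reg} (ha : r ≠ a) (hb : r ≠ b) (t : ℕ) : round ρ a b t r = ρ r := by
  simp [round, ha, hb]

theorem round_self (a b : Reg) (t : ℕ) : round ρ a b t b = t := by simp [round]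

theorem den_ticks (r : Reg) : (ticks r).den w ρ = unary (ρ r) := by
  simpa [ticks, den, unary] using flatMap_replicate (ρ r) 1 Symb.tick

theorem den_pairs {p : Reg} (hp : pair ≠ p) : (pairs p).den w ρ = unary (ρ p * ρ pair) := by
  have : (fun t => (loop pair z' (emit [Symb.tick]) : Gen α Symb Reg).den w (round ρ p z t)) =
      fun _ => List.replicate (ρ pair) Symb.tick := by
    funext t
    rw [← round_of_ne (ρ := ρ) hp (show pair ≠ z by decide) t]
    simpa [den] using flatMap_replicate (round ρ p z t pair) 1 Symb.tick
  rw [pairs, den, this, flatMap_replicate]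
  rfl

theorem encode_vars (p k : ℕ) :
    (vars p k).flatMap Term.encode =
      (List.range k).flatMap fun t => Symb.var :: unary (p + t) := by
  simp [vars, List.flatMap_map, Term.encode]

theorem den_block {n p : Reg} {off : Gen α Symb Reg} {o : ℕ} (hn : pair ≠ n) (hp : pair ≠ p)
    (hpn : p ≠ n) (hpj : p ≠ j) (ho : ∀ t, off.den w (round ρ n j t) = unary o) :
    (block n p off).den w ρ = (vars (ρ p * ρ pair + o) (ρ n)).flatMap Term.encode := by
  rw [encode_vars, block, den]
  congr 1
  funext t
  simp only [den, den_pairs hp, den_ticks, ho, round_self, round_of_ne hpn hpj,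
    round_of_ne hn (show pair ≠ j by decide)]
  simp [unary, Nat.add_assoc]

theorem den_block_nil {n p : Reg} (hn : pair ≠ n) (hp : pair ≠ p) (hpn : p ≠ n) (hpj : p ≠ j) :
    (block n p (emit [])).den w ρ = (vars (ρ p * ρ pair) (ρ n)).flatMap Term.encode :=
  den_block (o := 0) hn hp hpn hpj fun _ => rfl

theorem den_stack {n : Reg} (hn : pair ≠ n) (hn' : pair' ≠ n) (h : ρ pair' = ρ pair) :
    (stack n).den w ρ = (vars 0 (ρ n * ρ pair)).flatMap Term.encode := by
  rw [← flatMap_vars, List.flatMap_assoc, stack, den]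
  congr 1
  funext t
  rw [den_block_nil (by decide) (by decide) (by decide) (by decide), round_self,
    round_of_ne hn (by decide), round_of_ne hn' (by decide), h]

theorem den_constant (c : ℕ) : (constant c).den w ρ = [Term.const c].flatMap Term.encode := by
  simp [constant, den, Term.encode]

theorem den_stateConst (b c : ℕ) :
    (stateConst b c).den w ρ = [Term.const (b + c * ρ i)].flatMap Term.encode := by
  simp only [stateConst, den, den_constant, unary, flatMap_replicate]
  simp [Term.encode, unary, Nat.mul_comm]

theorem den_head (s : Bool) (p : Reg) :
    (head s p).den w ρ = (if s then Symb.pos else Symb.neg) :: unary (ρ p) := by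
  simp [head, den, den_ticks]

theorem encode_equiv (A B : Atom) : ClauseSet.encode (equiv A B) =
    (A.lit false).encode ++ ((B.lit true).encode ++ ([Symb.endClause] ++
      ((A.lit true).encode ++ ((B.lit false).encode ++ [Symb.endClause])))) := by
  simp [ClauseSet.encode, equiv, Clause.encode]

theorem den_equivGen {A B : Bool → Gen α Symb Reg} {A' B' : Atom}
    (hA : ∀ s, (A s).den w ρ = (A'.lit s).encode) (hB : ∀ s, (B s).den w ρ = (B'.lit s).encode) :
    (equivGen A B).den w ρ = ClauseSet.encode (equiv A' B') := by
  simp only [equivGen, den, hA, hB, encode_equiv]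

variable {N K : ℕ}

theorem den_stackLit (h : ρ pair = 2 * (N + 1)) (h' : ρ pair' = 2 * (N + 1)) (mode : ℕ) (s : Bool) :
    (stackLit mode s).den w ρ = ((stackAtom N (ρ d) mode).lit s).encode := by
  rw [stackAtom, Nat.succ_mul, ← vars_append]
  simp only [stackLit, den, den_head, den_stack (show pair ≠ d by decide)
    (show pair' ≠ d by decide) (h'.trans h.symm), den_constant, h, h',
    den_block_nil (show pair ≠ pair' by decide) (show pair ≠ d by decide)
    (show d ≠ pair' by decide) (show d ≠ j by decide), Atom.lit, Literal.encode,
    List.flatMap_append, List.append_assoc, List.cons_append, Nat.zero_add]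

theorem den_pushLit (h : ρ pair = 2 * (N + 1)) (h' : ρ pair' = 2 * (N + 1))
    (hw : ρ width = N + 1) {off : Gen α Symb Reg} {b : ℕ}
    (hb : ∀ t, off.den w (round ρ width j t) = unary b) (mode : ℕ) (s : Bool) :
    (pushLit off mode s).den w ρ = ((pushAtom N (ρ d) b mode).lit s).encode := by
  rw [pushAtom, Nat.succ_mul, ← vars_append]
  have hp : ∀ t, (ticks pair : Gen α Symb Reg).den w (round ρ width j t) = unary (ρ pair) :=
    fun t => by rw [den_ticks, round_of_ne (by decide) (by decide)]
  simp only [pushLit, den, den_head, den_stack (show pair ≠ d by decide)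
    (show pair' ≠ d by decide) (h'.trans h.symm), den_constant,
    den_block_nil (show pair ≠ pair' by decide) (show pair ≠ d by decide)
    (show d ≠ pair' by decide) (show d ≠ j by decide),
    den_block (show pair ≠ width by decide) (show pair ≠ d by decide)
    (show d ≠ width by decide) (show d ≠ j by decide) hb,
    den_block (show pair ≠ width by decide) (show pair ≠ d by decide)
    (show d ≠ width by decide) (show d ≠ j by decide) hp, h, h', hw, Atom.lit, Literal.encode,
    List.flatMap_append, List.append_assoc, List.cons_append, Nat.zero_add, unary,
    List.replicate_succ', List.nil_append]

theorem den_reflLit (h : ρ pair = 2 * (N + 1)) (h' : ρ pair' = 2 * (N + 1))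
    (hw : ρ width = N + 1) (mode : ℕ) (s : Bool) :
    (reflLit mode s).den w ρ = ((reflAtom N (ρ depth) mode).lit s).encode := by
  simp only [reflAtom, reflLit, den, den_head, den_stack (show pair ≠ depth by decide)
    (show pair' ≠ depth by decide) (h'.trans h.symm), den_constant,
    den_block_nil (show pair ≠ width by decide) (show pair ≠ depth by decide)
    (show depth ≠ width by decide) (show depth ≠ j by decide), h, hw, Atom.lit, Literal.encode,
    List.flatMap_append, List.cons_append]
  rfl

theorem den_row (h : ρ pair = 2 * (N + 1)) (hc : ρ cells = N - 1 - ρ i) (x : Scan) :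
    (row x).den w ρ = (rowTerms N (ρ depth * (2 * (N + 1))) (ρ i) x.sym
      (x.code (ρ i))).flatMap Term.encode := by
  have hi : ∀ t, (ticks i ;; emit [Symb.tick] : Gen α Symb Reg).den w (round ρ cells j t) =
      unary (ρ i + 1) := fun t => by
    simp [den, den_ticks, round_of_ne (show i ≠ cells by decide) (show i ≠ j by decide), unary,
      List.replicate_succ']
  have hn : (ifZero i (constant x.code₀) (stateConst x.base x.mul) : Gen α Symb Reg).den w ρ =
      [Term.const (x.code (ρ i))].flatMap Term.encode := by
    rw [den, den_constant, den_stateConst, Scan.code]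
    split_ifs <;> rfl
  rw [row, den, den, den, hn]
  simp only [rowTerms, den_constant,
    den_block_nil (show pair ≠ i by decide) (show pair ≠ depth by decide)
    (show depth ≠ i by decide) (show depth ≠ j by decide),
    den_block (show pair ≠ cells by decide) (show pair ≠ depth by decide)
    (show depth ≠ cells by decide) (show depth ≠ j by decide) hi, h, hc,
    List.flatMap_append, List.flatMap_cons, List.flatMap_nil, List.append_assoc, List.nil_append]

theorem den_stepLit (h : ρ pair = 2 * (N + 1)) (h' : ρ pair' = 2 * (N + 1))
    (hc : ρ cells = N - 1 - ρ i) (r : Scan × Scan) (mode : ℕ) (s : Bool) :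
    (stepLit r mode s).den w ρ = ((stepAtom N (ρ depth) (ρ i) r mode).lit s).encode := by
  simp only [stepLit, stepAtom, den, den_head, den_stack (show pair ≠ depth by decide)
    (show pair' ≠ depth by decide) (h'.trans h.symm), den_constant, den_row h hc, h, Atom.lit,
    Literal.encode, List.flatMap_append, List.cons_append]
  rfl

theorem encode_flatMap {ι : Type} (l : List ι) (F : ι → ClauseSet) :
    ClauseSet.encode (l.flatMap F) = l.flatMap fun x => ClauseSet.encode (F x) := by
  simp [ClauseSet.encode, List.flatMap_assoc]

theorem encode_append (φ ψ : ClauseSet) :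
    ClauseSet.encode (φ ++ ψ) = ClauseSet.encode φ ++ ClauseSet.encode ψ := by
  simp [ClauseSet.encode]

theorem den_stepsGen (h : ρ pair = 2 * (N + 1)) (h' : ρ pair' = 2 * (N + 1))
    (hc : ρ cells = N - 1 - ρ i) (T : List (Scan × Scan)) :
    (stepsGen T).den w ρ = ClauseSet.encode (T.flatMap fun r =>
      equiv (stepAtom N (ρ depth) (ρ i) r 0) (stepAtom N (ρ depth) (ρ i) r 1)) := by
  induction T with
  | nil => rfl
  | cons r T ih =>
    rw [stepsGen, den, ih, den_equivGen (den_stepLit h h' hc r 0) (den_stepLit h h' hc r 1),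
      List.flatMap_cons, encode_append]

theorem den_goalLit (hc : ρ cells = N) (sym : α → ℕ) (blank start mode : ℕ) (s : Bool) :
    (goalLit sym blank start mode s).den w ρ = ClauseSet.encode
      [[(goalAtom N (w.map sym ++ List.replicate (ρ blanks) blank ++ [start]) mode).lit s]] := by
  have h₁ : ((List.range (ρ blanks)).flatMap fun _ => [Term.const blank].flatMap Term.encode) =
      (List.replicate (ρ blanks) (Term.const blank)).flatMap Term.encode := by
    rw [← List.flatMap_assoc]
    exact congrArg (List.flatMap _) ((flatMap_replicate _ 1 _).trans (by rw [mul_one]))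
  have h₂ : (loop cells j (emit [Symb.var] ;; ticks j) : Gen α Symb Reg).den w ρ =
      (vars 0 N).flatMap Term.encode := by
    simp [encode_vars, den, den_ticks, round_self, hc]
  have h₃ : (w.flatMap fun a => Symb.const :: unary (sym a)) =
      ((w.map sym).map Term.const).flatMap Term.encode := by
    simp [List.flatMap_map, Term.encode]
  rw [goalLit, den, den, den, den, den, den, h₂]
  simp only [den, den_constant, h₁, h₃]
  simp [ClauseSet.encode, Clause.encode, Literal.encode, Atom.lit, goalAtom, unary]

theorem den_pathGen (h : ρ pair = 2 * (N + 1)) (h' : ρ pair' = 2 * (N + 1))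
    (hw : ρ width = N + 1) (hw' : ρ width' = N + 1) (hc : ρ cells = N) (hK : ρ depth = K)
    (sym : α → ℕ) (blank start : ℕ) (T : List (Scan × Scan)) :
    (pathGen sym blank start T).den w ρ = ClauseSet.encode (pathClauses N K T
      (w.map sym ++ List.replicate (ρ blanks) blank ++ [start])) := by
  subst hK
  have h₀ : ∀ a b : Clause, ([a, b] : ClauseSet) = [a] ++ [b] := fun _ _ => rfl
  rw [pathGen, pathClauses, h₀]
  simp only [den, den_goalLit hc, encode_append, encode_flatMap,
    den_equivGen (den_reflLit h h' hw 0) (den_reflLit h h' hw 1)]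
  rw [hc]
  have h₁ : ∀ t, (equivGen (stackLit 0) (pushLit (emit []) 0) ;;
      equivGen (pushLit (emit []) 1) (pushLit (ticks width') 0) ;;
      equivGen (pushLit (ticks width') 1) (stackLit 1) : Gen α Symb Reg).den w
        (round ρ depth d t) = ClauseSet.encode (equiv (stackAtom N t 0) (pushAtom N t 0 0) ++
          (equiv (pushAtom N t 0 1) (pushAtom N t (N + 1) 0) ++
          equiv (pushAtom N t (N + 1) 1) (stackAtom N t 1))) := by
    intro t
    have e : ∀ {r : Reg} {n : ℕ}, ρ r = n → r ≠ depth → r ≠ d → round ρ depth d t r = n :=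
      fun hr h₁ h₂ => (round_of_ne h₁ h₂ t).trans hr
    have k := e h (by decide) (by decide)
    have k' := e h' (by decide) (by decide)
    have kw := e hw (by decide) (by decide)
    have kv : ∀ s, (ticks width' : Gen α Symb Reg).den w (round (round ρ depth d t) width j s) =
        unary (N + 1) := fun s => by
      rw [den_ticks, round_of_ne (by decide) (by decide), e hw' (by decide) (by decide)]
    have k₀ : ∀ s, (emit [] : Gen α Symb Reg).den w (round (round ρ depth d t) width j s) =
        unary 0 := fun _ => rfl
    have ks := fun mode s => den_stackLit (w := w) k k' mode s
    have kp := fun mode s => den_pushLit k k' kw k₀ mode s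
    have kq := fun mode s => den_pushLit k k' kw kv mode s
    rw [round_self] at ks kp kq
    simp only [den, encode_append, den_equivGen (ks 0) (kp 0), den_equivGen (kp 1) (kq 0),
      den_equivGen (kq 1) (ks 1)]
  have h₂ : ∀ t, (stepsGen T).den w (round ρ cells i t) = ClauseSet.encode (T.flatMap fun r =>
      equiv (stepAtom N (ρ depth) t r 0) (stepAtom N (ρ depth) t r 1)) := by
    intro t
    have e : ∀ {r : Reg} {n : ℕ}, ρ r = n → r ≠ cells → r ≠ i → round ρ cells i t r = n :=
      fun hr h₁ h₂ => (round_of_ne h₁ h₂ t).trans hr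
    rw [den_stepsGen (e h (by decide) (by decide)) (e h' (by decide) (by decide)),
      round_self, round_of_ne (by decide) (by decide)]
    -- What is left is the value of `cells` in round `t`, which is `N - 1 - t`.
    rw [round_self]
    simp [round, hc]
  simp only [den, encode_append] at h₁
  simp only [h₁, h₂, encode_flatMap, List.append_assoc]

end

end Gen

end StackProg

/-! ### The clause sets belong to the fragment -/

namespace EPR

/-- The pairs of atoms whose equivalence is expressed by `pathClauses`. -/
inductive Rule (N K : ℕ) (T : List (Scan × Scan)) : Atom → Atom → Prop
  | call {d} (h : d < K) : Rule N K T (stackAtom N d 0) (pushAtom N d 0 0)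
  | next {d} (h : d < K) : Rule N K T (pushAtom N d 0 1) (pushAtom N d (N + 1) 0)
  | ret {d} (h : d < K) : Rule N K T (pushAtom N d (N + 1) 1) (stackAtom N d 1)
  | refl : Rule N K T (reflAtom N K 0) (reflAtom N K 1)
  | step {i r} (h : i < N) (hr : r ∈ T) :
      Rule N K T (stepAtom N K i r 0) (stepAtom N K i r 1)

variable {N K : ℕ} {T : List (Scan × Scan)} {init : List ℕ}

theorem mem_pathClauses {C : Clause} : C ∈ pathClauses N K T init ↔
    C = [(goalAtom N init 0).lit true] ∨ C = [(goalAtom N init 1).lit false] ∨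
      ∃ A B, Rule N K T A B ∧ (C = [A.lit false, B.lit true] ∨ C = [A.lit true, B.lit false]) := by
  constructor
  · intro h
    simp only [pathClauses, equiv, List.mem_append, List.mem_flatMap, List.mem_range,
      List.mem_cons, List.not_mem_nil, or_false] at h
    rcases h with (h | h) | ⟨d, hd, h | h | h⟩ | h | ⟨i, hi, r, hr, h⟩
    · exact .inl h
    · exact .inr (.inl h)
    · exact .inr (.inr ⟨_, _, .call hd, h⟩)
    · exact .inr (.inr ⟨_, _, .next hd, h⟩)
    · exact .inr (.inr ⟨_, _, .ret hd, h⟩)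
    · exact .inr (.inr ⟨_, _, .refl, h⟩)
    · exact .inr (.inr ⟨_, _, .step hi hr, h⟩)
  · simp only [pathClauses, equiv, List.mem_append, List.mem_flatMap, List.mem_range,
      List.mem_cons, List.not_mem_nil, or_false]
    rintro (h | h | ⟨A, B, hAB, h⟩)
    · exact .inl (.inl h)
    · exact .inl (.inr h)
    · refine .inr ?_
      cases hAB with
      | call hd => exact .inl ⟨_, hd, .inl h⟩
      | next hd => exact .inl ⟨_, hd, .inr (.inl h)⟩
      | ret hd => exact .inl ⟨_, hd, .inr (.inr h)⟩
      | refl => exact .inr (.inl h)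
      | step hi hr => exact .inr (.inr ⟨_, hi, _, hr, h⟩)

theorem length_vars (p k : ℕ) : (vars p k).length = k := by simp [vars]

theorem mem_vars {u p k : ℕ} : Term.var u ∈ vars p k ↔ p ≤ u ∧ u < p + k := by
  simp only [vars, List.mem_map, List.mem_range, Term.var.injEq]
  constructor
  · rintro ⟨j, hj, rfl⟩; omega
  · rintro ⟨h₁, h₂⟩; exact ⟨u - p, by omega, by omega⟩

theorem length_rowTerms {p i a q : ℕ} (hi : i < N) : (rowTerms N p i a q).length = N + 1 := by
  simp only [rowTerms, List.length_append, length_vars, List.length_cons, List.length_nil]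
  omega

/-- The arity is a function of the predicate number, as well-formedness requires. -/
theorem Rule.length {A B : Atom} (h : Rule N K T A B) :
    A.2.length = (A.1 + 1) * (2 * (N + 1)) + 1 ∧ B.2.length = (B.1 + 1) * (2 * (N + 1)) + 1 := by
  cases h with
  | step hi hr =>
    simp only [stepAtom, List.length_append, length_vars, length_rowTerms hi, List.length_cons,
      List.length_nil]
    constructor <;> ring
  | _ =>
    simp only [stackAtom, pushAtom, reflAtom, List.length_append, length_vars, List.length_cons,
      List.length_nil]
    constructor <;> first | trivial | ring

/-- Argument lists with a common prefix that contains all common variables. -/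
def SharedPrefix (a b : List Term) : Prop :=
  ∃ p r s, a = p ++ r ∧ b = p ++ s ∧
    ∀ u, Term.var u ∈ r → Term.var u ∈ s → Term.var u ∈ p

theorem SharedPrefix.symm {a b : List Term} (h : SharedPrefix a b) : SharedPrefix b a := by
  obtain ⟨p, r, s, h₁, h₂, h⟩ := h
  exact ⟨p, s, r, h₂, h₁, fun u hu hu' => h u hu' hu⟩

/-- A common variable occurs in the prefix already, so its first position lies there, and up to that
position the lists coincide. -/
theorem SharedPrefix.idxOf_eq {a b : List Term} (h : SharedPrefix a b) {u : ℕ}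
    (ha : Term.var u ∈ a) (hb : Term.var u ∈ b) :
    a.idxOf (Term.var u) = b.idxOf (Term.var u) ∧
      ∀ j ≤ a.idxOf (Term.var u), a[j]? = b[j]? := by
  obtain ⟨p, r, s, rfl, rfl, h⟩ := h
  have hp : Term.var u ∈ p := by
    rw [List.mem_append] at ha hb
    rcases ha with ha | ha
    · exact ha
    · rcases hb with hb | hb
      · exact hb
      · exact h u ha hb
  rw [List.idxOf_append_of_mem hp, List.idxOf_append_of_mem hp]
  refine ⟨rfl, fun j hj => ?_⟩
  have := List.idxOf_lt_length_iff.2 hp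
  rw [List.getElem?_append_left (by omega), List.getElem?_append_left (by omega)]

/-- In `call` and `ret` the shorter atom has only its mode after the prefix. In `next` the prefix
includes the new configuration, and the copies behind it repeat variables of the pair below. In
`refl` and `step` the atoms differ in the mode alone. -/
theorem Rule.sharedPrefix {A B : Atom} (h : Rule N K T A B) : SharedPrefix A.2 B.2 := by
  cases h with
  | call hd => exact ⟨_, _, _, rfl, rfl, by simp⟩
  | @next d hd =>
    refine ⟨vars 0 ((d + 1) * (2 * (N + 1))) ++ vars ((d + 1) * (2 * (N + 1))) (N + 1), _, _,
      (List.append_assoc ..).symm, (List.append_assoc ..).symm, fun u hu _ => ?_⟩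
    simp only [List.mem_append, mem_vars, List.mem_singleton, reduceCtorEq, or_false] at hu ⊢
    rw [Nat.succ_mul]
    omega
  | ret hd => exact SharedPrefix.symm ⟨_, _, _, rfl, rfl, by simp⟩
  | refl =>
    refine ⟨vars 0 (K * (2 * (N + 1))) ++ (vars (K * (2 * (N + 1))) (N + 1) ++
      vars (K * (2 * (N + 1))) (N + 1)), [Term.const 0], [Term.const 1], ?_, ?_, by simp⟩ <;>
    simp [reflAtom]
  | @step i r hi hr =>
    refine ⟨vars 0 (K * (2 * (N + 1))) ++
      (rowTerms N (K * (2 * (N + 1))) i r.1.sym (r.1.code i) ++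
      rowTerms N (K * (2 * (N + 1))) i r.2.sym (r.2.code i)), [Term.const 0], [Term.const 1],
      ?_, ?_, by simp⟩ <;>
    simp [stepAtom]

theorem wellFormed_pathClauses (hinit : init.length = N + 1) :
    WellFormed (pathClauses N K T init) := by
  constructor
  · intro C hC
    rcases mem_pathClauses.1 hC with rfl | rfl | ⟨A, B, -, rfl | rfl⟩ <;> simp [Atom.lit]
  · have key : ∀ C ∈ pathClauses N K T init, ∀ l ∈ C,
        l.args.length = (l.pred + 1) * (2 * (N + 1)) + 1 := by
      intro C hC l hl
      rcases mem_pathClauses.1 hC with rfl | rfl | ⟨A, B, hAB, rfl | rfl⟩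
      · simp only [List.mem_singleton] at hl
        subst hl
        simp only [Atom.lit, goalAtom, List.length_append, List.length_map, hinit, length_vars,
          List.length_cons, List.length_nil]
        ring
      · simp only [List.mem_singleton] at hl
        subst hl
        simp only [Atom.lit, goalAtom, List.length_append, List.length_map, hinit, length_vars,
          List.length_cons, List.length_nil]
        ring
      all_goals
        simp only [List.mem_cons, List.not_mem_nil, or_false] at hl
        rcases hl with rfl | rfl
        exacts [hAB.length.1, hAB.length.2]
    intro C hC C' hC' l hl l' hl' h
    rw [key C hC l hl, key C' hC' l' hl', h]

theorem qealm_pathClauses : QEALM (pathClauses N K T init) := by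
  intro C hC l hl l' hl' u hu hu'
  rcases mem_pathClauses.1 hC with rfl | rfl | ⟨A, B, hAB, rfl | rfl⟩
  · simp only [List.mem_singleton] at hl hl'
    subst hl hl'
    exact ⟨rfl, fun _ _ => rfl⟩
  · simp only [List.mem_singleton] at hl hl'
    subst hl hl'
    exact ⟨rfl, fun _ _ => rfl⟩
  all_goals
    simp only [List.mem_cons, List.not_mem_nil, or_false] at hl hl'
    rcases hl with rfl | rfl <;> rcases hl' with rfl | rfl
    · exact ⟨rfl, fun _ _ => rfl⟩
    · exact hAB.sharedPrefix.idxOf_eq hu hu'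
    · exact hAB.sharedPrefix.symm.idxOf_eq hu hu'
    · exact ⟨rfl, fun _ _ => rfl⟩

theorem krom_pathClauses : Krom (pathClauses N K T init) := by
  intro C hC
  rcases mem_pathClauses.1 hC with rfl | rfl | ⟨A, B, -, rfl | rfl⟩ <;> simp

theorem horn_pathClauses : Horn (pathClauses N K T init) := by
  intro C hC
  rcases mem_pathClauses.1 hC with rfl | rfl | ⟨A, B, -, rfl | rfl⟩ <;> simp [Atom.lit]

/-- Complementing both literals of one clause of an equivalence gives its other clause. -/
theorem affine_pathClauses : Affine (pathClauses N K T init) := by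
  intro l₁ l₂ h
  left
  rw [mem_pathClauses] at h ⊢
  rcases h with h | h | ⟨A, B, hAB, h | h⟩
  · simp at h
  · simp at h
  · simp only [List.cons.injEq, and_true] at h
    obtain ⟨rfl, rfl⟩ := h
    exact .inr (.inr ⟨A, B, hAB, .inr rfl⟩)
  · simp only [List.cons.injEq, and_true] at h
    obtain ⟨rfl, rfl⟩ := h
    exact .inr (.inr ⟨A, B, hAB, .inl rfl⟩)

end EPR

/-! ### Models of the clause sets -/

namespace EPR

/-- The values of the variables number `p, …, p + k - 1`. -/
def seg {D : Type} (v : ℕ → D) (p k : ℕ) : List D := (List.range k).map fun j => v (p + j)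

theorem length_seg {D : Type} (v : ℕ → D) (p k : ℕ) : (seg v p k).length = k := by simp [seg]

theorem seg_append {D : Type} (v : ℕ → D) (p k l : ℕ) :
    seg v p k ++ seg v (p + k) l = seg v p (k + l) := by
  simp [seg, List.range_add, Nat.add_assoc]

/-- A valuation that reads off a concatenation gives consecutive blocks of variables any prescribed
values; the default `x` is not read within the block. -/
theorem seg_getD {D : Type} (x : D) (l₁ l₂ l₃ : List D) {p k : ℕ} (hp : l₁.length = p)
    (hk : l₂.length = k) : seg (fun n => (l₁ ++ (l₂ ++ l₃)).getD n x) p k = l₂ := by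
  subst hp hk
  apply List.ext_getElem
  · simp [seg]
  · intro n h₁ h₂
    simp [seg, List.getElem?_append_right, List.getElem?_append_left h₂, List.getElem?_eq_getElem h₂]

/-- The atom holds under the valuation `v`. -/
def Interpretation.HoldsAtom {D : Type} (I : Interpretation D) (v : ℕ → D) (A : Atom) : Prop :=
  I.pred A.1 (A.2.map (I.term v))

theorem Interpretation.map_vars {D : Type} (I : Interpretation D) (v : ℕ → D) (p k : ℕ) :
    (vars p k).map (I.term v) = seg v p k := by
  simp [vars, seg, Interpretation.term]

/-- The interpretation `I` satisfies `pathClauses N K T init`, expressed by configurations. -/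
structure IsPathModel {D : Type} (I : Interpretation D) (N K : ℕ) (T : List (Scan × Scan))
    (init : List ℕ) : Prop where
  start : ∀ c : List D, c.length = N →
    I.pred 0 (init.map I.const ++ ((c ++ [I.const 0]) ++ [I.const 0]))
  goal : ∀ c : List D, c.length = N →
    ¬ I.pred 0 (init.map I.const ++ ((c ++ [I.const 0]) ++ [I.const 1]))
  call : ∀ d < K, ∀ s a b x : List D, s.length = d * (2 * (N + 1)) → a.length = N + 1 →
    b.length = N + 1 → x.length = N + 1 → (I.pred d (s ++ (a ++ (b ++ [I.const 0]))) ↔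
      I.pred (d + 1) (s ++ (a ++ (b ++ (x ++ (a ++ [I.const 0]))))))
  next : ∀ d < K, ∀ s a b x : List D, s.length = d * (2 * (N + 1)) → a.length = N + 1 →
    b.length = N + 1 → x.length = N + 1 →
      (I.pred (d + 1) (s ++ (a ++ (b ++ (x ++ (a ++ [I.const 1]))))) ↔
      I.pred (d + 1) (s ++ (a ++ (b ++ (x ++ (b ++ [I.const 0]))))))
  ret : ∀ d < K, ∀ s a b x : List D, s.length = d * (2 * (N + 1)) → a.length = N + 1 →
    b.length = N + 1 → x.length = N + 1 →
      (I.pred (d + 1) (s ++ (a ++ (b ++ (x ++ (b ++ [I.const 1]))))) ↔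
        I.pred d (s ++ (a ++ (b ++ [I.const 1]))))
  refl : ∀ s a : List D, s.length = K * (2 * (N + 1)) → a.length = N + 1 →
    (I.pred K (s ++ (a ++ (a ++ [I.const 0]))) ↔ I.pred K (s ++ (a ++ (a ++ [I.const 1]))))
  step : ∀ s u v : List D, ∀ i < N, ∀ r ∈ T, s.length = K * (2 * (N + 1)) → u.length = i →
    v.length = N - 1 - i →
    (I.pred K (s ++ ((u ++ I.const r.1.sym :: (v ++ [I.const (r.1.code i)])) ++
      ((u ++ I.const r.2.sym :: (v ++ [I.const (r.2.code i)])) ++ [I.const 0]))) ↔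
    I.pred K (s ++ ((u ++ I.const r.1.sym :: (v ++ [I.const (r.1.code i)])) ++
      ((u ++ I.const r.2.sym :: (v ++ [I.const (r.2.code i)])) ++ [I.const 1]))))

section

variable {D : Type} {I : Interpretation D} {N K : ℕ} {T : List (Scan × Scan)} {init : List ℕ}

theorem holds_pathClauses : (∀ C ∈ pathClauses N K T init, I.HoldsClause C) ↔
    (∀ v, I.HoldsAtom v (goalAtom N init 0)) ∧ (∀ v, ¬ I.HoldsAtom v (goalAtom N init 1)) ∧
      ∀ A B, Rule N K T A B → ∀ v, (I.HoldsAtom v A ↔ I.HoldsAtom v B) := by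
  have h₁ : ∀ (v : ℕ → D) (A : Atom), I.HoldsLiteral v (A.lit true) ↔ I.HoldsAtom v A :=
    fun v A => by simp [Interpretation.HoldsLiteral, Atom.lit, Interpretation.HoldsAtom]
  have h₂ : ∀ (v : ℕ → D) (A : Atom), I.HoldsLiteral v (A.lit false) ↔ ¬ I.HoldsAtom v A :=
    fun v A => by simp [Interpretation.HoldsLiteral, Atom.lit, Interpretation.HoldsAtom]
  constructor
  · intro h
    refine ⟨fun v => ?_, fun v => ?_, fun A B hAB v => ?_⟩
    · simpa [h₁] using h _ (mem_pathClauses.2 (.inl rfl)) v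
    · simpa [h₂] using h _ (mem_pathClauses.2 (.inr (.inl rfl))) v
    · have k₁ := h _ (mem_pathClauses.2 (.inr (.inr ⟨A, B, hAB, .inl rfl⟩))) v
      have k₂ := h _ (mem_pathClauses.2 (.inr (.inr ⟨A, B, hAB, .inr rfl⟩))) v
      simp only [List.mem_cons, List.not_mem_nil, or_false, exists_eq_or_imp, exists_eq_left,
        h₁, h₂] at k₁ k₂
      tauto
  · rintro ⟨k₁, k₂, k₃⟩ C hC v
    rcases mem_pathClauses.1 hC with rfl | rfl | ⟨A, B, hAB, rfl | rfl⟩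
    · simpa [h₁] using k₁ v
    · simpa [h₂] using k₂ v
    all_goals
      have := k₃ A B hAB v
      simp only [List.mem_cons, List.not_mem_nil, or_false, exists_eq_or_imp, exists_eq_left,
        h₁, h₂]
      tauto

variable {v : ℕ → D}

theorem holds_goalAtom {mode : ℕ} : I.HoldsAtom v (goalAtom N init mode) ↔
    I.pred 0 (init.map I.const ++ ((seg v 0 N ++ [I.const 0]) ++ [I.const mode])) := by
  simp [Interpretation.HoldsAtom, goalAtom, I.map_vars, Interpretation.term, Function.comp_def]

theorem seg_pair (v : ℕ → D) (d N : ℕ) : seg v 0 ((d + 1) * (2 * (N + 1))) =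
    seg v 0 (d * (2 * (N + 1))) ++ (seg v (d * (2 * (N + 1))) (N + 1) ++
      seg v (d * (2 * (N + 1)) + (N + 1)) (N + 1)) := by
  have e : 2 * (N + 1) = (N + 1) + (N + 1) := by ring
  rw [seg_append, Nat.succ_mul, ← seg_append, Nat.zero_add]
  exact congrArg _ (congrArg _ e)

theorem holds_stackAtom {d mode : ℕ} : I.HoldsAtom v (stackAtom N d mode) ↔
    I.pred d (seg v 0 (d * (2 * (N + 1))) ++ (seg v (d * (2 * (N + 1))) (N + 1) ++
      (seg v (d * (2 * (N + 1)) + (N + 1)) (N + 1) ++ [I.const mode]))) := by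
  simp [Interpretation.HoldsAtom, stackAtom, I.map_vars, seg_pair, Interpretation.term]

theorem holds_pushAtom {d b mode : ℕ} : I.HoldsAtom v (pushAtom N d b mode) ↔
    I.pred (d + 1) (seg v 0 (d * (2 * (N + 1))) ++ (seg v (d * (2 * (N + 1))) (N + 1) ++
      (seg v (d * (2 * (N + 1)) + (N + 1)) (N + 1) ++
      (seg v ((d + 1) * (2 * (N + 1))) (N + 1) ++
        (seg v (d * (2 * (N + 1)) + b) (N + 1) ++ [I.const mode]))))) := by
  simp [Interpretation.HoldsAtom, pushAtom, I.map_vars, seg_pair, Interpretation.term]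

theorem holds_reflAtom {mode : ℕ} : I.HoldsAtom v (reflAtom N K mode) ↔
    I.pred K (seg v 0 (K * (2 * (N + 1))) ++ (seg v (K * (2 * (N + 1))) (N + 1) ++
      (seg v (K * (2 * (N + 1))) (N + 1) ++ [I.const mode]))) := by
  simp [Interpretation.HoldsAtom, reflAtom, I.map_vars, Interpretation.term]

theorem holds_stepAtom {i mode : ℕ} {r : Scan × Scan} : I.HoldsAtom v (stepAtom N K i r mode) ↔
    I.pred K (seg v 0 (K * (2 * (N + 1))) ++
      ((seg v (K * (2 * (N + 1))) i ++ I.const r.1.sym ::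
        (seg v (K * (2 * (N + 1)) + (i + 1)) (N - 1 - i) ++ [I.const (r.1.code i)])) ++
      ((seg v (K * (2 * (N + 1))) i ++ I.const r.2.sym ::
        (seg v (K * (2 * (N + 1)) + (i + 1)) (N - 1 - i) ++ [I.const (r.2.code i)])) ++
          [I.const mode]))) := by
  simp [Interpretation.HoldsAtom, stepAtom, rowTerms, I.map_vars, Interpretation.term]

/-- This trades valuations for lists: given lists are concatenated and read off as a valuation, and
conversely a valuation is cut into segments. -/
theorem isPathModel_iff :
    (∀ C ∈ pathClauses N K T init, I.HoldsClause C) ↔ IsPathModel I N K T init := by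
  rw [holds_pathClauses]
  constructor
  · rintro ⟨h₁, h₂, h₃⟩
    have key : ∀ (d : ℕ) (s a b x : List D), s.length = d * (2 * (N + 1)) → a.length = N + 1 →
        b.length = N + 1 → x.length = N + 1 → ∃ v : ℕ → D, seg v 0 (d * (2 * (N + 1))) = s ∧
        seg v (d * (2 * (N + 1))) (N + 1) = a ∧ seg v (d * (2 * (N + 1)) + (N + 1)) (N + 1) = b ∧
        seg v ((d + 1) * (2 * (N + 1))) (N + 1) = x := by
      intro d s a b x hs ha hb hx
      refine ⟨fun n => (s ++ (a ++ (b ++ x))).getD n (I.const 0),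
        seg_getD _ [] s _ rfl hs, seg_getD _ s a _ hs ha, ?_, ?_⟩
      · have := seg_getD (I.const 0) (s ++ a) b x (by rw [List.length_append, hs, ha]) hb
        rwa [List.append_assoc] at this
      · have := seg_getD (I.const 0) (s ++ (a ++ b)) x [] (p := (d + 1) * (2 * (N + 1)))
          (by simp only [List.length_append, hs, ha, hb]; ring) hx
        rwa [List.append_assoc, List.append_assoc, List.append_nil] at this
    constructor
    · intro c hc
      have := holds_goalAtom.1 (h₁ fun n => c.getD n (I.const 0))
      have e := seg_getD (I.const 0) [] c [] (p := 0) rfl hc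
      rw [List.nil_append, List.append_nil] at e
      rwa [e] at this
    · intro c hc
      have := mt holds_goalAtom.2 (h₂ fun n => c.getD n (I.const 0))
      have e := seg_getD (I.const 0) [] c [] (p := 0) rfl hc
      rw [List.nil_append, List.append_nil] at e
      rwa [e] at this
    · intro d hd s a b x hs ha hb hx
      obtain ⟨v, e₁, e₂, e₃, e₄⟩ := key d s a b x hs ha hb hx
      have := h₃ _ _ (.call hd) v
      rwa [holds_stackAtom, holds_pushAtom, Nat.add_zero (d * (2 * (N + 1))), e₁, e₂, e₃, e₄] at this
    · intro d hd s a b x hs ha hb hx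
      obtain ⟨v, e₁, e₂, e₃, e₄⟩ := key d s a b x hs ha hb hx
      have := h₃ _ _ (.next hd) v
      rwa [holds_pushAtom, holds_pushAtom, Nat.add_zero (d * (2 * (N + 1))), e₁, e₂, e₃, e₄] at this
    · intro d hd s a b x hs ha hb hx
      obtain ⟨v, e₁, e₂, e₃, e₄⟩ := key d s a b x hs ha hb hx
      have := h₃ _ _ (.ret hd) v
      rwa [holds_pushAtom, holds_stackAtom, e₁, e₂, e₃, e₄] at this
    · intro s a hs ha
      obtain ⟨v, e₁, e₂, -⟩ := key K s a a a hs ha ha ha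
      have := h₃ _ _ .refl v
      rwa [holds_reflAtom, holds_reflAtom, e₁, e₂] at this
    · intro s u w i hi r hr hs hu hw
      -- The variable of cell `i` occurs in neither atom, since a constant takes its place; the
      -- entry `I.const 0` merely keeps the numbering.
      have := h₃ _ _ (.step hi hr)
        (fun n => (s ++ (u ++ (I.const 0 :: w))).getD n (I.const 0))
      rw [holds_stepAtom, holds_stepAtom] at this
      have e₁ := seg_getD (I.const 0) [] s (u ++ (I.const 0 :: w)) (p := 0) rfl hs
      have e₂ := seg_getD (I.const 0) s u (I.const 0 :: w) hs hu
      have e₃ := seg_getD (I.const 0) (s ++ (u ++ [I.const 0])) w []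
        (p := K * (2 * (N + 1)) + (i + 1)) (by simp [hs, hu]) hw
      simp only [List.append_assoc, List.append_nil, List.singleton_append] at e₃
      rw [List.nil_append] at e₁
      rwa [e₁, e₂, e₃] at this
  · intro h
    refine ⟨fun v => holds_goalAtom.2 (h.start _ (length_seg ..)),
      fun v => mt holds_goalAtom.1 (h.goal _ (length_seg ..)), fun A B hAB v => ?_⟩
    cases hAB with
    | call hd =>
      rw [holds_stackAtom, holds_pushAtom]
      exact h.call _ hd _ _ _ _ (length_seg ..) (length_seg ..) (length_seg ..) (length_seg ..)
    | next hd =>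
      rw [holds_pushAtom, holds_pushAtom]
      exact h.next _ hd _ _ _ _ (length_seg ..) (length_seg ..) (length_seg ..) (length_seg ..)
    | ret hd =>
      rw [holds_pushAtom, holds_stackAtom]
      exact h.ret _ hd _ _ _ _ (length_seg ..) (length_seg ..) (length_seg ..) (length_seg ..)
    | refl =>
      rw [holds_reflAtom, holds_reflAtom]
      exact h.refl _ _ (length_seg ..) (length_seg ..)
    | step hi hr =>
      rw [holds_stepAtom, holds_stepAtom]
      exact h.step _ _ _ _ hi _ hr (length_seg ..) (length_seg ..) (length_seg ..)

end

end EPR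

/-! ### Satisfiability and reachability -/

/-- `a` and `b` are connected by a path of length at most `2 ^ k`, found by bisection. -/
def PathLE {X : Type} (E : X → X → Prop) : ℕ → X → X → Prop
  | 0, a, b => a = b ∨ E a b
  -- Both halves start at the midpoint, in the order in which the atoms list a pushed pair; for
  -- symmetric `E` this is ordinary bisection.
  | k + 1, a, b => ∃ c, PathLE E k c a ∧ PathLE E k c b

namespace PathLE

variable {X : Type} {E : X → X → Prop}

protected theorem refl (k : ℕ) (a : X) : PathLE E k a a := by
  induction k with
  | zero => exact .inl rfl
  | succ k ih => exact ⟨a, ih, ih⟩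

protected theorem symm (hE : ∀ a b, E a b → E b a) {k : ℕ} {a b : X} (h : PathLE E k a b) :
    PathLE E k b a := by
  cases k with
  | zero => exact h.imp Eq.symm (hE a b)
  | succ k =>
    obtain ⟨c, h₁, h₂⟩ := h
    exact ⟨c, h₂, h₁⟩

theorem of_chain (hE : ∀ a b, E a b → E b a) (x : ℕ → X) {n : ℕ}
    (hx : ∀ i < n, E (x i) (x (i + 1))) {k s t : ℕ} (hst : s ≤ t) (htn : t ≤ n)
    (hk : t - s ≤ 2 ^ k) : PathLE E k (x s) (x t) := by
  induction k generalizing s t with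
  | zero =>
    rcases hst.eq_or_lt with rfl | h
    · exact .inl rfl
    · obtain rfl : t = s + 1 := by rw [pow_zero] at hk; omega
      exact .inr (hx s (by omega))
  | succ k ih =>
    rw [pow_succ] at hk
    -- The midpoint is capped at `t` for chains shorter than `2 ^ k`; the first half is reversed to
    -- start at the midpoint.
    exact ⟨x (min t (s + 2 ^ k)),
      (ih (le_min hst (by omega)) (by omega) (by omega)).symm hE,
      ih (min_le_left _ _) htn (by omega)⟩

theorem iff_of_closed {P : X → Prop} (hP : ∀ a b, E a b → (P a ↔ P b)) {k : ℕ} {a b : X}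
    (h : PathLE E k a b) : P a ↔ P b := by
  induction k generalizing a b with
  | zero =>
    rcases h with rfl | h
    · rfl
    · exact hP a b h
  | succ k ih =>
    obtain ⟨c, h₁, h₂⟩ := h
    exact (ih h₁).symm.trans (ih h₂)

end PathLE

/-! ### A path refutes every model -/

namespace EPR

/-- The transitions between configurations with `N` cells, written as lists. -/
def StepRel (N : ℕ) (T : List (Scan × Scan)) (a b : List ℕ) : Prop :=
  ∃ u v : List ℕ, ∃ i < N, ∃ r ∈ T, u.length = i ∧ v.length = N - 1 - i ∧
    a = u ++ r.1.sym :: (v ++ [r.1.code i]) ∧ b = u ++ r.2.sym :: (v ++ [r.2.code i])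

section

variable {N K : ℕ} {T : List (Scan × Scan)} {init : List ℕ}

theorem StepRel.symm (hT : ∀ r ∈ T, r.swap ∈ T) (a b : List ℕ) (h : StepRel N T a b) :
    StepRel N T b a := by
  obtain ⟨u, v, i, hi, r, hr, hu, hv, ha, hb⟩ := h
  exact ⟨u, v, i, hi, r.swap, hT r hr, hu, hv, hb, ha⟩

theorem StepRel.length {a b : List ℕ} (h : StepRel N T a b) :
    a.length = N + 1 ∧ b.length = N + 1 := by
  obtain ⟨u, v, i, hi, r, hr, hu, hv, rfl, rfl⟩ := h
  simp only [List.length_append, List.length_cons, List.length_nil, hu, hv]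
  omega

/-- Induction on the remaining depth follows the recursion: call, first query, switch, second query,
return. The clauses hold for every pushed configuration, in particular for the midpoint of the path.
Constants may coincide in `D`, because only images of lists under `I.const` are used. -/
theorem IsPathModel.pred_iff {D : Type} {I : Interpretation D} (h : IsPathModel I N K T init)
    {k d : ℕ} (hd : d + k = K) {a b : List ℕ} (hab : PathLE (StepRel N T) k a b)
    (ha : a.length = N + 1) {s : List D} (hs : s.length = d * (2 * (N + 1))) :
    I.pred d (s ++ (a.map I.const ++ (b.map I.const ++ [I.const 0]))) ↔
      I.pred d (s ++ (a.map I.const ++ (b.map I.const ++ [I.const 1]))) := by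
  have hlen : ∀ {k a b}, PathLE (StepRel N T) k a b → (a.length = N + 1 ↔ b.length = N + 1) :=
    fun h => h.iff_of_closed fun a b h => ⟨fun _ => h.length.2, fun _ => h.length.1⟩
  induction k generalizing d a b s with
  | zero =>
    obtain rfl : d = K := hd
    rcases hab with rfl | ⟨u, v, i, hi, r, hr, hu, hv, rfl, rfl⟩
    · exact h.refl s _ hs (by simpa)
    · simpa using h.step s (u.map I.const) (v.map I.const) i hi r hr hs (by simpa) (by simpa)
  | succ k ih =>
    obtain ⟨x, hxa, hxb⟩ := hab
    have hx := (hlen hxa).2 ha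
    have hb := (hlen hxb).1 hx
    have hd' : d + 1 + k = K := by omega
    have hdK : d < K := by omega
    have hs' : (s ++ (a.map I.const ++ b.map I.const)).length = (d + 1) * (2 * (N + 1)) := by
      simp only [List.length_append, List.length_map, hs, ha, hb]
      ring
    have k₁ := ih hd' hxa hx hs'
    have k₂ := ih hd' hxb hx hs'
    simp only [List.append_assoc] at k₁ k₂
    have ha' : (a.map I.const).length = N + 1 := by simpa
    have hb' : (b.map I.const).length = N + 1 := by simpa
    have hx' : (x.map I.const).length = N + 1 := by simpa
    exact (h.call d hdK s _ _ _ hs ha' hb' hx').trans <| k₁.trans <|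
      (h.next d hdK s _ _ _ hs ha' hb' hx').trans <| k₂.trans <|
      h.ret d hdK s _ _ _ hs ha' hb' hx'

theorem not_satisfiable_of_pathLE (hinit : init.length = N + 1) {c : List ℕ} (hc : c.length = N)
    (h : PathLE (StepRel N T) K init (c ++ [0])) : ¬ Satisfiable (pathClauses N K T init) := by
  rintro ⟨D, I, hI⟩
  rw [isPathModel_iff] at hI
  have := hI.pred_iff (d := 0) (Nat.zero_add K) h hinit (s := []) (by simp)
  rw [List.map_append] at this
  exact hI.goal (c.map I.const) (by simpa) (this.1 (hI.start (c.map I.const) (by simpa)))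

end

/-! ### A model when there is no path -/

section

variable {X : Type} (E : X → X → Prop) (K : ℕ)

/-- The truth values of the atoms with a given sequence of configurations, for both modes, in the
model of the clause set. -/
def val (B : ℕ → X) : ℕ → Prop × Prop
  -- At the bottom every call is true, and a return is true only for pairs that are connected.
  | 0 => (True, PathLE E K (B 0) (B 1))
  | d + 1 =>
    let a := B (2 * d)
    let b := B (2 * d + 1)
    let x := B (2 * d + 2)
    let y := B (2 * d + 3)
    let p := val B d
    -- `q` is the common value of the return from `(x, a)` and the call on `(x, b)`. It has to agree
    -- with `p.1` if `x` and `a` are connected; otherwise it may be `p.2`.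
    let q := (PathLE E (K - (d + 1)) x a ∧ p.1) ∨ (¬ PathLE E (K - (d + 1)) x a ∧ p.2)
    -- If `y` is neither `a` nor `b`, the pair was not pushed by a legitimate call, and both modes
    -- are false.
    ((y = a ∧ p.1) ∨ (y ≠ a ∧ y = b ∧ q), (y = a ∧ q) ∨ (y ≠ a ∧ y = b ∧ p.2))

variable {E K}

theorem val_congr {B B' : ℕ → X} {d : ℕ} (h : ∀ j < 2 * d + 2, B j = B' j) :
    val E K B d = val E K B' d := by
  induction d with
  | zero => rw [val, val, h 0 (by omega), h 1 (by omega)]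
  | succ d ih =>
    rw [val, val, ih fun j hj => h j (by omega), h (2 * d) (by omega), h (2 * d + 1) (by omega),
      h (2 * d + 2) (by omega), h (2 * d + 3) (by omega)]

/-- The critical case is `y = b` with `x` connected to `b`. If `x` is also connected to `a`, it is a
midpoint between `a` and `b`, so `p.1` and `p.2` agree by induction; if not, `q` is `p.2` by
definition. -/
theorem val_iff_of_pathLE {B : ℕ → X} {d : ℕ} (hd : d ≤ K)
    (h : PathLE E (K - d) (B (2 * d)) (B (2 * d + 1))) : (val E K B d).1 ↔ (val E K B d).2 := by
  induction d with
  | zero =>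
    rw [val]
    exact iff_of_true trivial h
  | succ d ih =>
    have e : K - d = (K - (d + 1)) + 1 := by omega
    have ih' : ∀ x, PathLE E (K - (d + 1)) x (B (2 * d)) →
        PathLE E (K - (d + 1)) x (B (2 * d + 1)) → ((val E K B d).1 ↔ (val E K B d).2) :=
      fun x h₁ h₂ => ih (by omega) (by rw [e]; exact ⟨x, h₁, h₂⟩)
    have ih'' := ih' (B (2 * d + 2))
    have h₃ : 2 * (d + 1) = 2 * d + 2 := by ring
    rw [h₃] at h
    rw [val]
    dsimp only
    by_cases hy : B (2 * d + 3) = B (2 * d)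
    · rw [hy] at h
      simp [hy, h]
    by_cases hy' : B (2 * d + 3) = B (2 * d + 1)
    · rw [hy'] at h
      rw [hy'] at hy
      simp only [hy', hy, false_and, false_or, ne_eq, not_false_eq_true, true_and]
      tauto
    · simp [hy, hy']

theorem val_call {B : ℕ → X} {d : ℕ} (h : B (2 * d + 3) = B (2 * d)) :
    (val E K B (d + 1)).1 ↔ (val E K B d).1 := by
  rw [val]
  simp [h]

/-- `B` and `B'` agree below the last entry. If `a = b`, the definition of `val` takes the case `y =
a` on both sides; this is consistent because `PathLE` is reflexive, so that both modes of the pair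
below agree. The same applies to `val_ret`. -/
theorem val_next {B B' : ℕ → X} {d : ℕ} (hd : d < K) (h : B (2 * d + 3) = B (2 * d))
    (h' : B' (2 * d + 3) = B' (2 * d + 1)) (hB : ∀ j < 2 * d + 3, B j = B' j) :
    (val E K B (d + 1)).2 ↔ (val E K B' (d + 1)).1 := by
  have e := val_congr (E := E) (K := K) (d := d) fun j hj => hB j (by omega)
  have h₀ := fun h => val_iff_of_pathLE (E := E) (K := K) (B := B') hd.le h
  rw [val, val, e, hB (2 * d) (by omega), hB (2 * d + 1) (by omega), hB (2 * d + 2) (by omega),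
    h, h', hB (2 * d) (by omega)]
  dsimp only
  by_cases hab : B' (2 * d + 1) = B' (2 * d)
  · rw [hab] at h₀
    have := h₀ (PathLE.refl _ _)
    simp only [hab, true_and, ne_eq, not_true_eq_false, false_and, or_false]
    tauto
  · simp [hab]

theorem val_ret {B : ℕ → X} {d : ℕ} (hd : d < K) (h : B (2 * d + 3) = B (2 * d + 1)) :
    (val E K B (d + 1)).2 ↔ (val E K B d).2 := by
  have h₀ := fun h => val_iff_of_pathLE (E := E) (K := K) (B := B) hd.le h
  rw [val]
  dsimp only
  rw [h]
  by_cases hab : B (2 * d + 1) = B (2 * d)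
  · rw [hab] at h₀
    have := h₀ (PathLE.refl _ _)
    simp only [hab, true_and, ne_eq, not_true_eq_false, false_and, or_false]
    tauto
  · simp [hab]

end

section

variable {N K : ℕ} {T : List (Scan × Scan)} {init : List ℕ}

/-- The configuration number `j` in a list of arguments. -/
def blockAt (N : ℕ) (l : List ℕ) (j : ℕ) : List ℕ := (l.drop (j * (N + 1))).take (N + 1)

/-- The model of the clause set. -/
def pathModel (N K : ℕ) (T : List (Scan × Scan)) : Interpretation ℕ where
  const := id
  pred d l := (l.getLast? = some 0 ∧ (val (StepRel N T) K (blockAt N l) d).1) ∨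
    (l.getLast? = some 1 ∧ (val (StepRel N T) K (blockAt N l) d).2)

theorem blockAt_append {s a r : List ℕ} {j : ℕ} (hs : s.length = j * (N + 1))
    (ha : a.length = N + 1) : blockAt N (s ++ (a ++ r)) j = a := by
  rw [blockAt, ← hs, List.drop_left, ← ha, List.take_left]

theorem blockAt_congr {s r r' : List ℕ} {j : ℕ} (hs : (j + 1) * (N + 1) ≤ s.length) :
    blockAt N (s ++ r) j = blockAt N (s ++ r') j := by
  rw [Nat.succ_mul] at hs
  have : N + 1 ≤ (s.drop (j * (N + 1))).length := by
    rw [List.length_drop]; omega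
  rw [blockAt, blockAt, List.drop_append_of_le_length (by omega),
    List.drop_append_of_le_length (by omega), List.take_append_of_le_length this,
    List.take_append_of_le_length this]

theorem pathModel_pred_zero {d : ℕ} {l : List ℕ} : (pathModel N K T).pred d (l ++ [0]) ↔
    (val (StepRel N T) K (blockAt N (l ++ [0])) d).1 := by
  simp [pathModel]

theorem pathModel_pred_one {d : ℕ} {l : List ℕ} : (pathModel N K T).pred d (l ++ [1]) ↔
    (val (StepRel N T) K (blockAt N (l ++ [1])) d).2 := by
  simp [pathModel]

theorem val_blockAt_congr {d : ℕ} {s r r' : List ℕ} (hs : s.length = (d + 1) * (2 * (N + 1))) :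
    val (StepRel N T) K (blockAt N (s ++ r)) d = val (StepRel N T) K (blockAt N (s ++ r')) d := by
  refine val_congr fun j hj => blockAt_congr ?_
  rw [hs, ← Nat.mul_assoc]
  exact Nat.mul_le_mul_right _ (by omega)

theorem blockAt_push {d : ℕ} {s a b x y r : List ℕ} (hs : s.length = d * (2 * (N + 1)))
    (ha : a.length = N + 1) (hb : b.length = N + 1) (hx : x.length = N + 1)
    (hy : y.length = N + 1) :
    blockAt N (s ++ (a ++ (b ++ (x ++ (y ++ r))))) (2 * d) = a ∧
    blockAt N (s ++ (a ++ (b ++ (x ++ (y ++ r))))) (2 * d + 1) = b ∧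
    blockAt N (s ++ (a ++ (b ++ (x ++ (y ++ r))))) (2 * d + 3) = y := by
  have hs' : s.length = 2 * d * (N + 1) := by rw [hs]; ring
  have h₁ := blockAt_append (N := N) (s := s ++ a) (a := b) (r := x ++ (y ++ r)) (j := 2 * d + 1)
    (by rw [List.length_append, hs', ha]; ring) hb
  have h₃ := blockAt_append (N := N) (s := s ++ (a ++ (b ++ x))) (a := y) (r := r)
    (j := 2 * d + 3) (by simp only [List.length_append, hs', ha, hb, hx]; ring) hy
  simp only [List.append_assoc] at h₁ h₃
  exact ⟨blockAt_append hs' ha, h₁, h₃⟩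

theorem satisfiable_of_not_pathLE (hinit : init.length = N + 1)
    (h : ∀ c : List ℕ, c.length = N → ¬ PathLE (StepRel N T) K init (c ++ [0])) :
    Satisfiable (pathClauses N K T init) := by
  refine ⟨ℕ, pathModel N K T, isPathModel_iff.2 ?_⟩
  have eid : init.map (pathModel N K T).const = init := List.map_id init
  have hid : ∀ n, (pathModel N K T).const n = n := fun _ => rfl
  -- This serves `refl` and `step` alike: at depth `K` the remaining index is `0`, where `PathLE`
  -- means equality or one step.
  have hbase : ∀ s a b : List ℕ, s.length = K * (2 * (N + 1)) → a.length = N + 1 →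
      b.length = N + 1 → (a = b ∨ StepRel N T a b) →
      ((pathModel N K T).pred K (s ++ (a ++ (b ++ [0]))) ↔
        (pathModel N K T).pred K (s ++ (a ++ (b ++ [1])))) := by
    intro s a b hs ha hb hab
    have e : ∀ r : List ℕ, s ++ (a ++ (b ++ r)) = (s ++ (a ++ b)) ++ r := by simp
    have hs' : s.length = 2 * K * (N + 1) := by rw [hs]; ring
    rw [e, e, pathModel_pred_zero, pathModel_pred_one,
      val_blockAt_congr (r := [0]) (r' := [1]) (by simp [hs, ha, hb]; ring)]
    refine val_iff_of_pathLE le_rfl ?_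
    rw [Nat.sub_self, ← e, blockAt_append hs' ha]
    have e' : s ++ (a ++ (b ++ [1])) = (s ++ a) ++ (b ++ [1]) := by simp
    rw [e', blockAt_append (by rw [List.length_append, hs', ha]; ring) hb]
    exact hab
  constructor
  · intro c hc
    rw [← List.append_assoc, hid, pathModel_pred_zero]
    trivial
  · intro c hc
    rw [eid, ← List.append_assoc, hid, hid, pathModel_pred_one]
    have h₁ := blockAt_append (N := N) (s := []) (a := init) (r := c ++ [0] ++ [1]) (j := 0)
      (by simp) hinit
    have h₂ := blockAt_append (N := N) (s := init) (a := c ++ [0]) (r := [1]) (j := 1)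
      (by simp [hinit]) (by simp [hc])
    rw [List.nil_append, ← List.append_assoc] at h₁
    rw [← List.append_assoc] at h₂
    rw [val, h₁, h₂]
    exact h c hc
  · intro d hd s a b x hs ha hb hx
    have e : ∀ r : List ℕ, s ++ (a ++ (b ++ r)) = (s ++ (a ++ b)) ++ r := by simp
    have hs' : (s ++ (a ++ b)).length = (d + 1) * (2 * (N + 1)) := by
      simp only [List.length_append, hs, ha, hb]; ring
    obtain ⟨h₀, -, h₃⟩ := blockAt_push (r := [0]) hs ha hb hx ha
    have k := val_call (E := StepRel N T) (K := K) (h₃.trans h₀.symm)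
    rw [hid, e, pathModel_pred_zero, val_blockAt_congr (r' := x ++ (a ++ [0])) hs', ← e,
      ← k, e, ← List.append_assoc x, ← List.append_assoc, pathModel_pred_zero]
  · intro d hd s a b x hs ha hb hx
    have e : ∀ y r : List ℕ, s ++ (a ++ (b ++ (x ++ (y ++ r)))) =
        (s ++ (a ++ (b ++ (x ++ y)))) ++ r := by simp
    have e' : ∀ r : List ℕ, s ++ (a ++ (b ++ (x ++ r))) = (s ++ (a ++ (b ++ x))) ++ r := by simp
    obtain ⟨h₀, -, h₃⟩ := blockAt_push (r := [1]) hs ha hb hx ha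
    obtain ⟨-, h₁', h₃'⟩ := blockAt_push (r := [0]) hs ha hb hx hb
    have k := val_next (E := StepRel N T) (K := K) hd (h₃.trans h₀.symm) (h₃'.trans h₁'.symm)
      fun j hj => by
        rw [e', e']
        refine blockAt_congr ?_
        have : (s ++ (a ++ (b ++ x))).length = (2 * d + 3) * (N + 1) := by
          simp only [List.length_append, hs, ha, hb, hx]; ring
        rw [this]
        exact Nat.mul_le_mul_right _ (by omega)
    rw [hid, hid, e, e, pathModel_pred_one, pathModel_pred_zero, ← e, ← e]
    exact k
  · intro d hd s a b x hs ha hb hx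
    have e : ∀ r : List ℕ, s ++ (a ++ (b ++ r)) = (s ++ (a ++ b)) ++ r := by simp
    have hs' : (s ++ (a ++ b)).length = (d + 1) * (2 * (N + 1)) := by
      simp only [List.length_append, hs, ha, hb]; ring
    obtain ⟨-, h₁, h₃⟩ := blockAt_push (r := [1]) hs ha hb hx hb
    have k := val_ret (E := StepRel N T) (K := K) hd (h₃.trans h₁.symm)
    rw [hid, e [1], pathModel_pred_one, val_blockAt_congr (r := [1]) (r' := x ++ (b ++ [1])) hs',
      ← e, ← k, e, ← List.append_assoc x, ← List.append_assoc, pathModel_pred_one]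
  · intro s a hs ha
    exact hbase s a a hs ha ha (.inl rfl)
  · intro s u v i hi r hr hs hu hv
    have hab : StepRel N T (u ++ r.1.sym :: (v ++ [r.1.code i]))
      (u ++ r.2.sym :: (v ++ [r.2.code i])) := ⟨u, v, i, hi, r, hr, hu, hv, rfl, rfl⟩
    exact hbase s _ _ hs hab.length.1 hab.length.2 (.inr hab)

end

end EPR

/-! ### Turing machines with polynomial space -/

namespace SingleTapeTM

open StateTransition EPR Function

variable {α : Type} (M : SingleTapeTM α)

/-- The number of states. -/
noncomputable def numQ : ℕ := Nat.card M.Q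

/-- The number of tape symbols. -/
noncomputable def numΓ : ℕ := Nat.card M.Γ

/-- The number of a tape symbol. -/
noncomputable def symCode (a : M.Γ) : ℕ := have := M.finΓ; Finite.equivFin M.Γ a

/-- The number of a state. -/
noncomputable def stateNum (q : M.Q) : ℕ := have := M.finQ; Finite.equivFin M.Q q

/-- The code of a state and a position of the head; it is not `0`. -/
noncomputable def stateCode (q : M.Q) (i : ℕ) : ℕ := 1 + M.stateNum q + M.numQ * (i + 1)

theorem symCode_injective : Injective M.symCode := by
  have := M.finΓ
  intro a b h
  exact (Finite.equivFin M.Γ).injective (Fin.ext h)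

theorem stateNum_lt (q : M.Q) : M.stateNum q < M.numQ :=
  have := M.finQ
  (Finite.equivFin M.Q q).isLt

/-- The state number is a remainder modulo `numQ`, and the quotient gives the head position. -/
theorem stateCode_inj {q q' : M.Q} {i i' : ℕ} (h : M.stateCode q i = M.stateCode q' i') :
    q = q' ∧ i = i' := by
  have := M.finQ
  have h₁ : M.stateNum q + M.numQ * (i + 1) = M.stateNum q' + M.numQ * (i' + 1) := by
    unfold stateCode at h; omega
  have hq := M.stateNum_lt q
  have hq' := M.stateNum_lt q'
  have h₂ := congrArg (· % M.numQ) h₁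
  simp only [Nat.add_mul_mod_self_left, Nat.mod_eq_of_lt hq, Nat.mod_eq_of_lt hq'] at h₂
  refine ⟨(Finite.equivFin M.Q).injective (Fin.ext h₂), ?_⟩
  rw [h₂, Nat.add_left_cancel_iff] at h₁
  have := Nat.eq_of_mul_eq_mul_left (by omega) h₁
  omega

/-- The position of the head after a move. -/
def moveHead : Turing.Dir → ℕ → ℕ
  | .left, i => i - 1
  | .right, i => i + 1

/-- What the machine sees in state `q` on symbol `a`. -/
noncomputable def scan (q : M.Q) (a : M.Γ) : Scan :=
  ⟨M.symCode a, M.stateCode q 0, 1 + M.stateNum q + M.numQ, M.numQ⟩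

/-- The cell left in a transition, with the code of the new state and head position. -/
noncomputable def scanMoved (q : M.Q) (a : M.Γ) : Turing.Dir → Scan
  | .left => ⟨M.symCode a, M.stateCode q 0, 1 + M.stateNum q, M.numQ⟩
  | .right => ⟨M.symCode a, M.stateCode q 1, 1 + M.stateNum q + 2 * M.numQ, M.numQ⟩

/-- The cell where the machine halts, with the state code `0`. -/
noncomputable def scanHalt (a : M.Γ) : Scan := ⟨M.symCode a, 0, 0, 0⟩

theorem scan_code (q : M.Q) (a : M.Γ) (i : ℕ) : (M.scan q a).code i = M.stateCode q i := by
  simp only [Scan.code, scan, stateCode]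
  split_ifs with h
  · simp [h]
  · ring

theorem scanMoved_sym (q : M.Q) (a : M.Γ) (d : Turing.Dir) :
    (M.scanMoved q a d).sym = M.symCode a := by
  cases d <;> rfl

/-- As the code uses `i + 1` for position `i`, a move to the left needs no negative base; `code₀`
takes care of the left end, where the head stays. -/
theorem scanMoved_code (q : M.Q) (a : M.Γ) (d : Turing.Dir) (i : ℕ) :
    (M.scanMoved q a d).code i = M.stateCode q (moveHead d i) := by
  cases d with
  | left =>
    simp only [Scan.code, scanMoved, stateCode, moveHead]
    split_ifs with h
    · simp [h]
    · obtain ⟨j, rfl⟩ := Nat.exists_eq_succ_of_ne_zero h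
      simp
  | right =>
    simp only [Scan.code, scanMoved, stateCode, moveHead]
    split_ifs with h
    · simp [h]
    · ring

theorem scanHalt_code (a : M.Γ) (i : ℕ) : (M.scanHalt a).code i = 0 := by
  simp [Scan.code, scanHalt]

/-- The transitions of the machine, where rejecting means to enter the state code `0`. -/
inductive Trans : Scan × Scan → Prop
  | move {q a q' a' d} (h : M.δ q a = some (q', a', d)) :
      Trans (M.scan q a, M.scanMoved q' a' d)
  | reject {q a} (h : M.δ q a = none) (hq : q ∉ M.accept) : Trans (M.scan q a, M.scanHalt a)

/-- The transitions of the machine and their inverses. -/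
def IsTransTable (T : List (Scan × Scan)) : Prop := ∀ r, r ∈ T ↔ M.Trans r ∨ M.Trans r.swap

/-- The table depends on the machine alone, so it is built into the reduction and never computed. -/
theorem exists_isTransTable : ∃ T, M.IsTransTable T := by
  have := M.finQ
  have := M.finΓ
  have hfin : {r | M.Trans r}.Finite := by
    classical
    refine (Set.finite_range fun p : M.Q × M.Γ => (M.δ p.1 p.2).elim
      (M.scan p.1 p.2, M.scanHalt p.2)
      fun x => (M.scan p.1 p.2, M.scanMoved x.1 x.2.1 x.2.2)).subset ?_
    rintro _ (@⟨q, a, q', a', d, h⟩ | @⟨q, a, h, -⟩)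
    · exact ⟨(q, a), by simp [h]⟩
    · exact ⟨(q, a), by simp [h]⟩
  have hfin' : {r | M.Trans r ∨ M.Trans r.swap}.Finite :=
    hfin.union (hfin.preimage Prod.swap_injective.injOn)
  refine ⟨hfin'.toFinset.toList, fun r => ?_⟩
  simp

/-- The list form of a configuration with `N` cells. -/
def rowOf (N : ℕ) (f : ℕ → ℕ) (h : ℕ) : List ℕ := (List.range N).map f ++ [h]

/-- The list form of a configuration of the machine, where only `N` cells are recorded. -/
noncomputable def row (N : ℕ) (c : M.Cfg) : List ℕ :=
  rowOf N (fun j => M.symCode (c.tape j)) (M.stateCode c.state c.head)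

theorem length_rowOf (N : ℕ) (f : ℕ → ℕ) (h : ℕ) : (rowOf N f h).length = N + 1 := by simp [rowOf]

theorem rowOf_eq {N i : ℕ} (hi : i < N) (f : ℕ → ℕ) (h : ℕ) : rowOf N f h =
    (List.range i).map f ++ f i :: ((List.range (N - 1 - i)).map (fun j => f (i + 1 + j)) ++ [h]) := by
  obtain ⟨k, rfl⟩ : ∃ k, N = i + 1 + k := ⟨N - (i + 1), by omega⟩
  simp [rowOf, List.range_add, Function.comp_def]

theorem rowOf_eq_iff {N i : ℕ} (hi : i < N) {f : ℕ → ℕ} {h s q : ℕ} {u v : List ℕ}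
    (hu : u.length = i) (hv : v.length = N - 1 - i) :
    rowOf N f h = u ++ s :: (v ++ [q]) ↔ (List.range i).map f = u ∧ f i = s ∧
      (List.range (N - 1 - i)).map (fun j => f (i + 1 + j)) = v ∧ h = q := by
  rw [rowOf_eq hi]
  constructor
  · intro e
    obtain ⟨h₁, h₂⟩ := List.append_inj e (by simp [hu])
    obtain ⟨h₃, h₄⟩ := List.cons.inj h₂
    obtain ⟨h₅, h₆⟩ := List.append_inj h₄ (by simp [hv])
    exact ⟨h₁, h₃, h₅, (List.cons.inj h₆).1⟩
  · rintro ⟨rfl, rfl, rfl, rfl⟩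
    rfl

/-- Replacing one symbol and the state code in the list form of a configuration. -/
theorem rowOf_replace {N i : ℕ} (hi : i < N) {f f' : ℕ → ℕ} {h h' s q : ℕ} {u v : List ℕ}
    (hu : u.length = i) (hv : v.length = N - 1 - i) (hf : ∀ j ≠ i, f' j = f j)
    (e : rowOf N f h = u ++ s :: (v ++ [q])) : rowOf N f' h' = u ++ f' i :: (v ++ [h']) := by
  obtain ⟨h₁, -, h₂, -⟩ := (rowOf_eq_iff hi hu hv).1 e
  refine (rowOf_eq_iff hi hu hv).2 ⟨?_, rfl, ?_, rfl⟩
  · rw [← h₁]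
    refine List.map_congr_left fun j hj => hf j ?_
    rw [List.mem_range] at hj
    omega
  · rw [← h₂]
    exact List.map_congr_left fun j hj => hf _ (by omega)

/-! ### Runs of the machine and paths of configurations -/

variable {M}

theorem step_eq_some {c : M.Cfg} {q a d} (h : M.δ c.state (c.tape c.head) = some (q, a, d)) :
    M.step c = some ⟨q, moveHead d c.head, update c.tape c.head a⟩ := by
  rw [step, h]
  cases d <;> rfl

theorem step_eq_none_iff {c : M.Cfg} : M.step c = none ↔ M.δ c.state (c.tape c.head) = none := by
  simp [step]

variable {T : List (Scan × Scan)} {N : ℕ}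

theorem stepRel_of_step (hT : M.IsTransTable T) {c c' : M.Cfg} (hc : c.head < N)
    (h : M.step c = some c') : StepRel N T (M.row N c) (M.row N c') := by
  have hne : M.δ c.state (c.tape c.head) ≠ none := fun h' => by
    rw [step_eq_none_iff.2 h'] at h; cases h
  obtain ⟨⟨q, a, d⟩, hδ⟩ := Option.ne_none_iff_exists'.1 hne
  rw [step_eq_some hδ] at h
  cases h
  have e := rowOf_eq hc (fun j => M.symCode (c.tape j)) (M.stateCode c.state c.head)
  refine ⟨(List.range c.head).map fun j => M.symCode (c.tape j),
    (List.range (N - 1 - c.head)).map fun j => M.symCode (c.tape (c.head + 1 + j)), _, hc, _,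
    (hT _).2 (.inl (.move hδ)), by simp, by simp, ?_, ?_⟩
  rotate_left
  · have := rowOf_replace hc (f' := fun j => M.symCode (update c.tape c.head a j))
      (h' := M.stateCode q (moveHead d c.head)) (by simp) (by simp)
      (fun j hj => by rw [update_of_ne hj]) e
    rw [row]
    dsimp only
    rw [this, scanMoved_sym, scanMoved_code, update_self]
  · rw [row, e, scan_code]
    rfl

theorem stepRel_of_reject (hT : M.IsTransTable T) {c : M.Cfg} (hc : c.head < N)
    (h : M.step c = none) (ha : c.state ∉ M.accept) :
    ∃ l : List ℕ, l.length = N ∧ StepRel N T (M.row N c) (l ++ [0]) := by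
  have e := rowOf_eq hc (fun j => M.symCode (c.tape j)) (M.stateCode c.state c.head)
  refine ⟨(List.range N).map fun j => M.symCode (c.tape j), by simp,
    (List.range c.head).map fun j => M.symCode (c.tape j),
    (List.range (N - 1 - c.head)).map fun j => M.symCode (c.tape (c.head + 1 + j)), _, hc, _,
    (hT _).2 (.inl (.reject (step_eq_none_iff.1 h) ha)), by simp, by simp, ?_, ?_⟩
  rotate_left
  · rw [scanHalt_code]
    exact rowOf_eq hc _ _
  · rw [row, e, scan_code]
    rfl

/-- The machine accepts, started in the configuration `c`. -/
def Accepts (c : M.Cfg) : Prop := ∃ c' ∈ eval M.step c, c'.state ∈ M.accept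

theorem accepts_iff_of_step {c c' : M.Cfg} (h : M.step c = some c') : Accepts c ↔ Accepts c' := by
  have : Reaches M.step c c' := Relation.ReflTransGen.single h
  rw [Accepts, Accepts, reaches_eval this]

theorem accepts_iff_of_none {c : M.Cfg} (h : M.step c = none) :
    Accepts c ↔ c.state ∈ M.accept := by
  constructor
  · rintro ⟨c', hc', h'⟩
    have := mem_eval.2 ⟨Relation.ReflTransGen.refl, h⟩
    rwa [Part.mem_unique this hc']
  · exact fun h' => ⟨c, mem_eval.2 ⟨Relation.ReflTransGen.refl, h⟩, h'⟩

/-- The list form of some configuration from which the machine accepts. -/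
def Good (N : ℕ) (M : SingleTapeTM α) (l : List ℕ) : Prop := ∃ c : M.Cfg, M.row N c = l ∧ Accepts c

theorem not_good_zero (l : List ℕ) : ¬ Good N M (l ++ [0]) := by
  rintro ⟨c, hc, -⟩
  have := List.append_inj_right' hc rfl
  simp [stateCode] at this

/-- Forwards this is a step of the machine. Backwards, the transition names the old state, symbol
and cell, so a predecessor can be built, and by determinism it leads back to the given
configuration. In the rejecting case neither side is good. Cells beyond `N` are harmless, since
`Good` asks for some configuration only. -/
theorem good_iff_of_trans {r : Scan × Scan} (hr : M.Trans r) {i : ℕ} (hi : i < N) {u v : List ℕ}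
    (hu : u.length = i) (hv : v.length = N - 1 - i) :
    Good N M (u ++ r.1.sym :: (v ++ [r.1.code i])) ↔
      Good N M (u ++ r.2.sym :: (v ++ [r.2.code i])) := by
  cases hr with
  | @move q a q' a' d h =>
    rw [scan_code, scanMoved_sym, scanMoved_code]
    constructor
    · rintro ⟨c, hc, hacc⟩
      obtain ⟨-, h₁, -, h₂⟩ := (rowOf_eq_iff hi hu hv).1 hc
      obtain ⟨h₃, h₄⟩ := M.stateCode_inj h₂
      replace h₁ := M.symCode_injective h₁
      subst h₃ h₁ h₄
      have hs := step_eq_some h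
      refine ⟨_, ?_, (accepts_iff_of_step hs).1 hacc⟩
      have := rowOf_replace hi (f' := fun j => M.symCode (update c.tape c.head a' j))
        (h' := M.stateCode q' (moveHead d c.head)) hu hv
        (fun j hj => by rw [update_of_ne hj]) hc
      rwa [update_self] at this
    · rintro ⟨c', hc, hacc⟩
      obtain ⟨-, h₁, -, h₂⟩ := (rowOf_eq_iff hi hu hv).1 hc
      obtain ⟨h₃, h₄⟩ := M.stateCode_inj h₂
      replace h₁ := M.symCode_injective h₁
      have hs := step_eq_some (c := ⟨q, i, update c'.tape i a⟩) (q := q') (a := a') (d := d)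
        (by simpa using h)
      have e : (⟨q', moveHead d i, update (update c'.tape i a) i a'⟩ : M.Cfg) = c' := by
        rw [update_idem, ← h₁, update_eq_self, ← h₃, ← h₄]
      refine ⟨⟨q, i, update c'.tape i a⟩, ?_, (accepts_iff_of_step (hs.trans (congrArg _ e))).2 hacc⟩
      have := rowOf_replace hi (f' := fun j => M.symCode (update c'.tape i a j))
        (h' := M.stateCode q i) hu hv (fun j hj => by rw [update_of_ne hj]) hc
      rwa [update_self] at this
  | @reject q a h hq =>
    rw [scan_code, scanHalt_code]
    refine iff_of_false ?_ ?_
    · rintro ⟨c, hc, hacc⟩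
      obtain ⟨-, h₁, -, h₂⟩ := (rowOf_eq_iff hi hu hv).1 hc
      obtain ⟨h₃, h₄⟩ := M.stateCode_inj h₂
      replace h₁ := M.symCode_injective h₁
      subst h₃ h₁ h₄
      exact hq ((accepts_iff_of_none (step_eq_none_iff.2 h)).1 hacc)
    · intro h'
      rw [← List.cons_append, ← List.append_assoc] at h'
      exact not_good_zero _ h'

theorem good_iff_of_stepRel (hT : M.IsTransTable T) (a b : List ℕ) (h : StepRel N T a b) :
    Good N M a ↔ Good N M b := by
  obtain ⟨u, v, i, hi, r, hr, hu, hv, rfl, rfl⟩ := h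
  rcases (hT r).1 hr with hr | hr
  · exact good_iff_of_trans hr hi hu hv
  · exact (good_iff_of_trans hr hi hu hv).symm

/-- After halting the sequence stays constant, so it is defined for all indices and equal members
have equal successors. -/
theorem exists_run {c c' : M.Cfg} (h : Reaches M.step c c') :
    ∃ (n : ℕ) (x : ℕ → M.Cfg), x 0 = c ∧ x n = c' ∧ (∀ k, x (k + 1) = (M.step (x k)).getD (x k)) ∧
      ∀ k < n, M.step (x k) = some (x (k + 1)) := by
  let x : ℕ → M.Cfg := fun k => (fun c => (M.step c).getD c)^[k] c
  have hx : ∀ k, x (k + 1) = (M.step (x k)).getD (x k) := fun k => iterate_succ_apply' _ _ _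
  suffices ∃ n, x n = c' ∧ ∀ k < n, M.step (x k) = some (x (k + 1)) from
    let ⟨n, h₁, h₂⟩ := this
    ⟨n, x, rfl, h₁, hx, h₂⟩
  induction h with
  | refl => exact ⟨0, rfl, by simp⟩
  | @tail b c' _ hb ih =>
    obtain ⟨n, rfl, hn⟩ := ih
    have hb : M.step (x n) = some c' := hb
    have e : x (n + 1) = c' := by rw [hx, hb]; rfl
    refine ⟨n + 1, e, fun k hk => ?_⟩
    rcases Nat.lt_succ_iff_lt_or_eq.1 hk with hk | rfl
    · exact hn k hk
    · rw [e, hb]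

theorem pathLE_of_reject (hT : M.IsTransTable T) {c₀ c : M.Cfg} (hc : c ∈ eval M.step c₀)
    (ha : c.state ∉ M.accept) (hN : ∀ c, Reaches M.step c₀ c → c.head < N)
    (hb : ∀ j, N ≤ j → c₀.tape j = M.blank) {K : ℕ}
    (hK : M.numQ * (N * M.numΓ ^ N) ≤ 2 ^ K) :
    ∃ l : List ℕ, l.length = N ∧ PathLE (StepRel N T) K (M.row N c₀) (l ++ [0]) := by
  have := M.finQ
  have := M.finΓ
  obtain ⟨hr, hnone⟩ := mem_eval.1 hc
  obtain ⟨n, x, rfl, rfl, hx, hn⟩ := exists_run hr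
  have hreach : ∀ k ≤ n, Reaches M.step (x 0) (x k) := by
    intro k hk
    induction k with
    | zero => exact .refl
    | succ k ih => exact (ih (by omega)).tail (hn k (by omega))
  have htape : ∀ k ≤ n, ∀ j, N ≤ j → (x k).tape j = M.blank := by
    intro k hk
    induction k with
    | zero => exact hb
    | succ k ih =>
      intro j hj
      have hstep := hn k (by omega)
      have hhead := hN _ (hreach k (by omega))
      cases hδ : M.δ (x k).state ((x k).tape (x k).head) with
      | none => rw [step_eq_none_iff.2 hδ] at hstep; cases hstep
      | some r =>
        obtain ⟨q, a, d⟩ := r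
        rw [step_eq_some hδ] at hstep
        rw [← Option.some.inj hstep]
        dsimp only
        rw [update_of_ne (by omega)]
        exact ih (by omega) j hj
  have hshift : ∀ s t, x s = x t → ∀ k, x (s + k) = x (t + k) := by
    intro s t hst k
    induction k with
    | zero => exact hst
    | succ k ih => rw [← Nat.add_assoc, ← Nat.add_assoc, hx, hx, ih]
  -- A repetition would carry over to the end of the run: an earlier member would equal the halting
  -- one, though it has a successor.
  have hlt : ∀ s t, s < t → t ≤ n → x s ≠ x t := by
    intro s t hst htn e
    have h₁ := hshift s t e (n - t)
    rw [Nat.add_sub_cancel' htn] at h₁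
    have h₂ := hn (s + (n - t)) (by omega)
    rw [h₁, hnone] at h₂
    cases h₂
  -- Cells from `N` on stay blank, so state, head and the first `N` cells determine the
  -- configuration.
  let F : Fin (n + 1) → M.Q × Fin N × (Fin N → M.Γ) := fun k =>
    ((x k).state, ⟨(x k).head, hN _ (hreach k (by omega))⟩, fun j => (x k).tape j)
  have hF : Injective F := by
    intro s t hst
    simp only [F, Prod.mk.injEq, Fin.mk.injEq] at hst
    obtain ⟨h₁, h₂, h₃⟩ := hst
    have e : x s = x t := by
      have h₄ : (x s).tape = (x t).tape := by
        funext j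
        rcases lt_or_ge j N with hj | hj
        · exact congrFun h₃ ⟨j, hj⟩
        · rw [htape s (by omega) j hj, htape t (by omega) j hj]
      cases hs : x s
      cases ht : x t
      simp only [hs, ht] at h₁ h₂ h₄
      rw [h₁, h₂, h₄]
    rcases lt_trichotomy s t with h | h | h
    · exact absurd e (hlt s t h (by omega))
    · exact h
    · exact absurd e.symm (hlt t s h (by omega))
  have hcard := Nat.card_le_card_of_injective F hF
  simp only [Nat.card_eq_fintype_card, Fintype.card_fin, Nat.card_prod, Nat.card_fun] at hcard
  obtain ⟨l, hl, hE⟩ := stepRel_of_reject hT (hN _ hr) hnone ha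
  refine ⟨l, hl, ?_⟩
  have hsymm : ∀ r ∈ T, r.swap ∈ T := fun r hr =>
    (hT _).2 (by rw [Prod.swap_swap]; exact ((hT r).1 hr).symm)
  -- The `n` steps of the run and the rejecting transition make `n + 1` edges, as many as the
  -- distinct configurations counted by `hcard`.
  have := PathLE.of_chain (E := StepRel N T) (StepRel.symm hsymm)
    (fun k => if k ≤ n then M.row N (x k) else l ++ [0]) (n := n + 1) (k := K) (fun k hk => by
      rcases Nat.lt_succ_iff_lt_or_eq.1 hk with hk | rfl
      · simp only [show k ≤ n by omega, show k + 1 ≤ n by omega, if_true]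
        exact stepRel_of_step hT (hN _ (hreach k (by omega))) (hn k hk)
      · simpa using hE) (Nat.zero_le (n + 1)) le_rfl (by
        refine le_trans ?_ (hcard.trans hK)
        simp)
  simpa using this

theorem mem_iff_not_pathLE (hT : M.IsTransTable T) {L : Set (List α)} {s : ℕ → ℕ}
    (hM : M.DecidesInSpace L s) (w : List α) (hs : s w.length ≤ N) (hw : w.length ≤ N) {K : ℕ}
    (hK : M.numQ * (N * M.numΓ ^ N) ≤ 2 ^ K) :
    w ∈ L ↔ ∀ l : List ℕ, l.length = N →
      ¬ PathLE (StepRel N T) K (M.row N (M.init w)) (l ++ [0]) := by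
  obtain ⟨⟨c, hc, hcL⟩, hspace⟩ := hM w
  constructor
  · intro hwL l hl h
    have := h.iff_of_closed (good_iff_of_stepRel hT)
    exact not_good_zero _ (this.1 ⟨_, rfl, c, hc, hcL.2 hwL⟩)
  · intro h
    by_contra hwL
    obtain ⟨l, hl, hpath⟩ := pathLE_of_reject hT hc (fun h => hwL (hcL.1 h))
      (fun c hc => (hspace c hc).trans_le hs) (fun j hj => by
        simp [init, List.getElem?_eq_none (hw.trans hj)]) hK
    exact h l hl hpath

theorem row_init (w : List α) {B : ℕ} (hN : N = w.length + B) : M.row N (M.init w) =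
    w.map (fun a => M.symCode (M.input a)) ++ List.replicate B (M.symCode M.blank) ++
      [M.stateCode M.start 0] := by
  subst hN
  rw [row, rowOf]
  congr 1
  rw [List.range_add, List.map_append]
  congr 1
  · apply List.ext_getElem
    · simp
    · intro n h₁ h₂
      have : n < w.length := by simpa using h₂
      simp [init, this]
  · rw [List.eq_replicate_iff]
    simp [init]

end SingleTapeTM

/-! ### The reduction -/

/-- The register program computes powers of `n + c`, so the space bound is enlarged to this form. -/
theorem Polynomial.exists_eval_le_add_pow (p : Polynomial ℕ) :
    ∃ c e : ℕ, ∀ n, p.eval n ≤ (n + c) ^ e := by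
  induction p using Polynomial.induction_on' with
  | add p q hp hq =>
    obtain ⟨c, e, h⟩ := hp
    obtain ⟨c', e', h'⟩ := hq
    -- The summand `2` makes the base at least `2`, so one further factor absorbs the sum of two
    -- powers.
    refine ⟨c + c' + 2, e + e' + 1, fun n => ?_⟩
    set b := n + (c + c' + 2)
    have hb : 2 ≤ b := by omega
    have h₁ : (n + c) ^ e ≤ b ^ (e + e') :=
      (Nat.pow_le_pow_left (by omega) e).trans (Nat.pow_le_pow_right (by omega) (by omega))
    have h₂ : (n + c') ^ e' ≤ b ^ (e + e') :=
      (Nat.pow_le_pow_left (by omega) e').trans (Nat.pow_le_pow_right (by omega) (by omega))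
    have := h n
    have := h' n
    calc (p + q).eval n = p.eval n + q.eval n := Polynomial.eval_add
      _ ≤ b ^ (e + e') * 2 := by omega
      _ ≤ b ^ (e + e' + 1) := by rw [pow_succ]; exact Nat.mul_le_mul_left _ hb
  | monomial k a =>
    refine ⟨a, k + 1, fun n => ?_⟩
    rw [Polynomial.eval_monomial, pow_succ, mul_comm]
    exact Nat.mul_le_mul (Nat.pow_le_pow_left (by omega) k) (by omega)

/-- The exponent is a constant multiple of `N`, so `depth` can be set by listing it a constant
number of times. -/
theorem Nat.mul_mul_pow_le_two_pow (q g : ℕ) {N : ℕ} (hN : 1 ≤ N) :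
    q * (N * g ^ N) ≤ 2 ^ ((q + 1 + g) * N) := by
  have h₁ : q ≤ 2 ^ (q * N) :=
    (Nat.lt_two_pow_self).le.trans (Nat.pow_le_pow_right (by omega) (Nat.le_mul_of_pos_right q hN))
  have h₂ : N ≤ 2 ^ N := (Nat.lt_two_pow_self).le
  have h₃ : g ^ N ≤ 2 ^ (g * N) := by
    rw [pow_mul]
    exact Nat.pow_le_pow_left (Nat.lt_two_pow_self).le N
  calc q * (N * g ^ N) ≤ 2 ^ (q * N) * (2 ^ N * 2 ^ (g * N)) :=
        Nat.mul_le_mul h₁ (Nat.mul_le_mul h₂ h₃)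
    _ = 2 ^ ((q + 1 + g) * N) := by rw [← pow_add, ← pow_add]; ring_nf

instance EPR.Symb.finite : Finite EPR.Symb :=
  Set.finite_univ_iff.1 <| (Set.toFinite
    {EPR.Symb.tick, .var, .const, .pos, .neg, .endClause}).subset fun s _ => by cases s <;> simp

namespace EPR

open StackProg StackProg.Reg

/-- The clause sets `pathClauses` for a space bound `n + (n + c) ^ e` are computable in polynomial
time. -/
theorem pathClauses_computableInPolyTime {α : Type} [Fintype α] (sym : α → ℕ) (blank start : ℕ)
    (T : List (Scan × Scan)) (k c e : ℕ) :
    Nonempty (Turing.TM2ComputableInPolyTime (id : List α → List α) ClauseSet.encode fun w =>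
      pathClauses (w.length + (w.length + c) ^ e) (k * (w.length + (w.length + c) ^ e)) T
        (w.map sym ++ List.replicate ((w.length + c) ^ e) blank ++ [start])) := by
  -- `W` is counted both with `n` and with `(n + c) ^ e`, so its registers receive multiples of `N`.
  -- The constant list adds `1` to the widths and `2` to the pairs; `blanks` receives `(n + c) ^ e`
  -- alone.
  let W : List Reg := [cells, width, width', pair, pair, pair', pair'] ++ List.replicate k depth
  refine gen_computableInPolyTime (R := Reg) (m := aux₀) (x := aux₁) (y := aux₂) (t := aux₃)
    (by decide) c e [width, width', pair, pair, pair', pair'] W (blanks :: W)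
    (Gen.pathGen sym blank start T) scratch (Gen.ok_pathGen sym blank start T) ?_ (by decide) _ _
    fun w => ?_
  · intro r hr
    have h : r ∉ [cells, width, width', pair, pair', blanks, depth] := by
      revert r; decide
    simp only [List.mem_cons, not_or] at h
    simp [W, h]
  · have h := Gen.den_pathGen (w := w)
      (ρ := regs c e [width, width', pair, pair, pair', pair'] W (blanks :: W) w.length)
      (N := w.length + (w.length + c) ^ e) (K := k * (w.length + (w.length + c) ^ e))
      (by simp [regs, W, List.count_replicate]; ring)
      (by simp [regs, W, List.count_replicate]; ring)
      (by simp [regs, W, List.count_replicate]; ring)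
      (by simp [regs, W, List.count_replicate]; ring)
      (by simp [regs, W, List.count_replicate])
      (by simp [regs, W]; ring) sym blank start T
    rw [h]
    simp [regs, W, List.count_replicate]

end EPR

theorem mainTheorem3 :
    PSPACEHard EPR.ClauseSet.encode
      {φ | EPR.WellFormed φ ∧ EPR.QEALM φ ∧ EPR.Krom φ ∧ EPR.Horn φ ∧ EPR.Affine φ}
      {φ | EPR.Satisfiable φ} := by
  intro α _ L ⟨M, s, hM⟩
  obtain ⟨c, e, hs⟩ := s.exists_eval_le_add_pow
  obtain ⟨T, hT⟩ := M.exists_isTransTable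
  refine ⟨_, EPR.pathClauses_computableInPolyTime (fun a => M.symCode (M.input a))
    (M.symCode M.blank) (M.stateCode M.start 0) T (M.numQ + 1 + M.numΓ) c e,
    fun w => ?_, fun w => ?_⟩
  · exact ⟨EPR.wellFormed_pathClauses (by simp; ring), EPR.qealm_pathClauses, EPR.krom_pathClauses,
      EPR.horn_pathClauses, EPR.affine_pathClauses⟩
  · have hsN : s.eval w.length ≤ w.length + (w.length + c) ^ e :=
      (hs _).trans (Nat.le_add_left _ _)
    -- The head scans a cell at the start, so the space bound is positive.
    have hN : 1 ≤ w.length + (w.length + c) ^ e :=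
      (Nat.zero_le _).trans_lt (((hM w).2 _ .refl).trans_le hsN)
    have hmem := SingleTapeTM.mem_iff_not_pathLE hT hM w hsN (Nat.le_add_right _ _)
      (Nat.mul_mul_pow_le_two_pow M.numQ M.numΓ hN)
    have hinit : (M.row (w.length + (w.length + c) ^ e) (M.init w)).length =
      w.length + (w.length + c) ^ e + 1 := SingleTapeTM.length_rowOf _ _ _
    rw [Set.mem_ofPred_eq, ← SingleTapeTM.row_init w rfl, hmem]
    constructor
    · exact EPR.satisfiable_of_not_pathLE hinit
    · intro h l hl hpath
      exact EPR.not_satisfiable_of_pathLE hinit hl hpath h
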